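/- \textbf{Proposition (linear damping in $L^2_t$).} For integrable $f$ on $\mathbb{R}^d$ write $\widehat f(p)=\int_{\mathbb{R}^d}e^{-ip\cdot v}f(v)\,dv$, and let $\langle x,y\rangle=(1+|x|^2+|y|^2)^{1/2}$. For $s\ge 0$ and an integer $M\ge0$, let $H^s_M(\mathbb{R}^d)$ be the space of functions $g$ with $\sum_{|\alpha|\le M}\|\langle\nabla\rangle^s(v^\alpha g)\|_{L^2}<\infty$. For $\hbar\in(0,1]$, $w,g\colon\mathbb{R}^d\to\mathbb{R}$, $t\geq0$ and $k\in\mathbb{R}^d$ put $$\widehat{\mathscr L}(t,k)=\frac{1}{(2\pi)^d}\,\frac{2}{\hbar}\,\widehat w(k)\,\sin\!\big(\tfrac{\hbar}{2}t|k|^2\big)\,\widehat g(kt),\qquad \widetilde{\mathscr L}(\lambda,k)=\int_0^\infty e^{-\lambda t}\,\widehat{\mathscr L}(t,k)\,dt .$$ The pair $(w,g)$ satisfies the uniform Penrose condition with constant $\kappa>0$ if, for every $\hbar\in(0,1]$, $$\inf_{\Re\lambda\ge0,\;k\in\mathbb{R}^d}\big|1+\widetilde{\mathscr L}(\lambda,k)\big|\ge\kappa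 .$$ Let $\sigma\ge0$ be an integer and $\delta_0>0$. Suppose that $w\in L^1(\mathbb{R}^d)$ and $g\in H^{\sigma+3/2+\delta_0}_{2+\lceil d/2\rceil}(\mathbb{R}^d)$ satisfy the uniform Penrose condition with constant $\kappa$. Then there exists a constant $C_{\mathrm{LD}}$, depending only on $\sigma,d,\delta_0,w,g,\kappa$ (in particular independent of $\hbar$, $T^*$, $m$, $k$, $H$ and $\phi$), such that for all $\hbar\in(0,1]$, $T^*>0$, $m\in\mathbb{R}$, every $k\in\mathbb{R}^d$ and every $H(\cdot,k)$ with $\big\||k|^m\langle k,kt\rangle^\sigma H(t,k)\big\|_{L^2_t([0,T^*])}<\infty$, any solution $\phi(\cdot,k)\in L^1([0,T^*])$ of the Volterra equation $$\phi(t,k)=H(t,k)-\int_0^t\widehat{\mathscr L}(t-s,k)\,\phi(s,k)\,ds\qquad\text{for a.e. }t\in[0,T^*]$$ satisfies $$\big\||k|^m\langle k,kt\rangle^\sigma\phi(t,k)\big\|_{L^2_t([0,T^*])}\le C_{\mathrm{LD}}\,\big\||k|^m\langle k,kt\rangle^\sigma H(t,k)\big\|_{L^2_t([0,T^*])}.$$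 (For $k=0$ and $m\neq0$ the factor $|k|^m$ is read as $0$, so that the estimate is trivial there.) -/

import Mathlib

open MeasureTheory Set Real
open scoped NNReal ENNReal

noncomputable section

/-- The Fourier transform `f̂(p) = ∫ e^{-i p·v} f(v) dv` of a real-valued function on `ℝ^d`. -/
def fourierHat {d : ℕ} (f : EuclideanSpace ℝ (Fin d) → ℝ) (p : EuclideanSpace ℝ (Fin d)) : ℂ :=
  ∫ v, Complex.exp (-(Complex.I * ((inner ℝ p v : ℝ) : ℂ))) * (f v : ℂ)

/-- The monomial `v^α` for a multi-index `α`. -/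
def monomialWeight {d : ℕ} (α : Fin d → ℕ) (v : EuclideanSpace ℝ (Fin d)) : ℝ :=
  ∏ i, v i ^ α i

/-- `g ∈ H^s_M(ℝ^d)`: for every multi-index `α` with `|α| ≤ M`, the function `v^α g` is in `L²`
and `⟨∇⟩^s (v^α g)` is in `L²` (the Bessel-potential Sobolev space of order `s`). -/
def MemWeightedSobolev {d : ℕ} (s : ℝ) (M : ℕ) (g : EuclideanSpace ℝ (Fin d) → ℝ) : Prop :=
  ∀ α : Fin d → ℕ, ∑ i, α i ≤ M →
    ∃ h : MemLp (fun v => ((monomialWeight α v * g v : ℝ) : ℂ)) 2 volume,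
      TemperedDistribution.MemSobolev s 2 (Lp.toTemperedDistribution (h.toLp _))

/-- The Hartree kernel
`𝓛̂(t,k) = (2π)^{-d} (2/ħ) ŵ(k) sin(ħ t |k|² / 2) ĝ(k t)`. -/
def hartreeKernel {d : ℕ} (hbar : ℝ) (w g : EuclideanSpace ℝ (Fin d) → ℝ)
    (t : ℝ) (k : EuclideanSpace ℝ (Fin d)) : ℂ :=
  ((1 / (2 * π) ^ d * (2 / hbar) : ℝ) : ℂ) * fourierHat w k *
    ((Real.sin (hbar / 2 * t * ‖k‖ ^ 2) : ℝ) : ℂ) * fourierHat g (t • k)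

/-- The Laplace transform in time of the Hartree kernel,
`𝓛̃(lam,k) = (2π)^{-d} (2/ħ) ŵ(k) ∫₀^∞ e^{-lam t} sin(ħ t |k|² / 2) ĝ(k t) dt`. -/
def hartreeLaplace {d : ℕ} (hbar : ℝ) (w g : EuclideanSpace ℝ (Fin d) → ℝ)
    (lam : ℂ) (k : EuclideanSpace ℝ (Fin d)) : ℂ :=
  ((1 / (2 * π) ^ d * (2 / hbar) : ℝ) : ℂ) * fourierHat w k *
    ∫ t in Ioi (0 : ℝ), Complex.exp (-(lam * (t : ℂ))) *
      ((Real.sin (1 / 2 * hbar * t * ‖k‖ ^ 2) : ℝ) : ℂ) * fourierHat g (t • k)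

/-- The uniform Penrose condition with constant `κ > 0`: for all `ħ ∈ (0,1]`,
`inf_{Re lam ≥ 0, k} |1 + 𝓛̃(lam,k)| ≥ κ`. -/
def UniformPenrose {d : ℕ} (w g : EuclideanSpace ℝ (Fin d) → ℝ) (κ : ℝ) : Prop :=
  0 < κ ∧ ∀ hbar ∈ Ioc (0 : ℝ) 1, ∀ lam : ℂ, 0 ≤ lam.re → ∀ k : EuclideanSpace ℝ (Fin d),
    κ ≤ ‖1 + hartreeLaplace hbar w g lam k‖

/-- The double Japanese bracket `⟨x,y⟩ = (1 + |x|² + |y|²)^{1/2}`. -/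
def japaneseBracket {d : ℕ} (x y : EuclideanSpace ℝ (Fin d)) : ℝ :=
  Real.sqrt (1 + ‖x‖ ^ 2 + ‖y‖ ^ 2)

/-- The function `t ↦ |k|^m ⟨k,kt⟩^σ f(t,k)` for fixed `k`. -/
def weightedMode {d : ℕ} (m : ℝ) (σ : ℕ) (f : ℝ → EuclideanSpace ℝ (Fin d) → ℂ)
    (k : EuclideanSpace ℝ (Fin d)) (t : ℝ) : ℂ :=
  ((‖k‖ ^ m * japaneseBracket k (t • k) ^ σ : ℝ) : ℂ) * f t k

/-- For the frequency `k`, `φ(·,k)` is an integrable solution on `[0,T]` of the Volterra equation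
`φ(t,k) = H(t,k) - ∫₀^t 𝓛̂(t-s,k) φ(s,k) ds`. -/
structure IsVolterraSolution {d : ℕ} (hbar : ℝ) (w g : EuclideanSpace ℝ (Fin d) → ℝ) (T : ℝ)
    (H φ : ℝ → EuclideanSpace ℝ (Fin d) → ℂ) (k : EuclideanSpace ℝ (Fin d)) : Prop where
  integrableOn : IntegrableOn (fun t => φ t k) (Icc 0 T) volume
  equation : ∀ᵐ t ∂(volume.restrict (Icc (0 : ℝ) T)),
    φ t k = H t k - ∫ s in (0 : ℝ)..t, hartreeKernel hbar w g (t - s) k * φ s k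

end

/-! ### Invertibility along continuous families of operators -/

section

open Filter Topology FourierTransform SchwartzMap BoundedContinuousFunction

/-! Fix `k ≠ 0` and let `K` be the kernel extended by zero to `t ≤ 0`. Let Φ, Η be the extensions of
`φ`, `H` by zero from `[0, T]` to the line. By causality (1 + K∗)Φ = Η + R with R supported in `[T,
∞)`. If 1 + K∗ is onto on functions supported in `[T, ∞)`, then R = (1 + K∗)u for such a u, hence (1
+ K∗)(Φ - u) = Η on the whole line. Plancherel and the Penrose bound on the imaginary axis give ‖Φ -
u‖ ≤ κ⁻¹‖Η‖, and ‖Φ‖ ≤ ‖Φ - u‖ because the supports meet in at most one point. The constant does not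
see `T` (`eLpNorm_volterra_le`).

Surjectivity uses Penrose in the open half-plane (`isUnit_causalOp`). The damped kernel exp(-μt)K
has Fourier symbol equal to the Laplace transform at μ + 2πiξ, so the damped operators are bounded
below by κ for all μ ≥ 0. For large μ a Neumann series inverts them, and the method of continuity
carries invertibility down to μ = 0.

For the weight, the bracket is at most √(1 + |k|²) + |k|t, whose first term is constant in time. For
powers of |k|t, the binomial expansion of |k|t = |k|(t - s) + |k|s leaves terms with kernel (|k|t)^j
K and lower powers on φ; Young's inequality and induction treat these as sources
(`exists_weighted_volterra_bound`).

What remains is to bound ∫(|k|t)^j |K| uniformly in ħ and k (`exists_moment_bound`). The bound |sin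
x| ≤ |x| removes 1/ħ, and scaling time by |k| reduces matters to weighted integrals of ĝ along lines
through the origin. Write g = θp with θ a negative power of 1 + |v|² and p in the Sobolev space.
Then ĝ is a convolution, and Peetre's inequality with Cauchy–Schwarz gives a weighted L² trace on
every line (`exists_lintegral_line_le`). Passing from L² to L¹ on the line costs slightly more than
half a derivative. -/

/-- Method of continuity: along a continuous family of operators that are uniformly bounded below,
invertibility propagates. -/
theorem isUnit_of_continuous_of_bounded_below {V : Type*} [NormedAddCommGroup V] [NormedSpace ℂ V]
    [CompleteSpace V] {A : ℝ≥0 → V →L[ℂ] V} (hA : Continuous A) {κ : ℝ} (hκ : 0 < κ)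
    (hlow : ∀ μ f, κ * ‖f‖ ≤ ‖A μ f‖) {μ₀ : ℝ≥0} (h₀ : IsUnit (A μ₀)) (μ : ℝ≥0) :
    IsUnit (A μ) := by
  have hclopen : IsClopen {μ | IsUnit (A μ)} := by
    refine ⟨⟨?_⟩, Units.isOpen.preimage hA⟩
    rw [isOpen_iff_mem_nhds]
    intro μ hμ
    have hnear : ∀ᶠ ν in 𝓝 μ, ‖A ν - A μ‖ < κ := by
      have := (hA.tendsto μ).eventually (Metric.ball_mem_nhds (A μ) hκ)
      filter_upwards [this] with ν hν
      rwa [← dist_eq_norm]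
    -- Closedness: an invertible A ν has inverse of norm at most κ⁻¹, uniformly in ν, so A μ = A ν
    -- (1 - (A ν)⁻¹(A ν - A μ)) is invertible by a Neumann series.
    filter_upwards [hnear] with ν hν hunit
    refine hμ ?_
    obtain ⟨u, hu⟩ := hunit
    have hinv : ‖(↑u⁻¹ : V →L[ℂ] V)‖ ≤ κ⁻¹ := by
      refine ContinuousLinearMap.opNorm_le_bound _ (by positivity) fun f => ?_
      have h1 := hlow ν ((↑u⁻¹ : V →L[ℂ] V) f)
      rw [← hu, ← mul_apply_eq_comp, Units.mul_inv, one_apply_eq_self] at h1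
      rwa [inv_mul_eq_div, le_div_iff₀ hκ, mul_comm]
    have hlt : ‖(↑u⁻¹ : V →L[ℂ] V) * (A ν - A μ)‖ < 1 := by
      refine (norm_mul_le _ _).trans_lt ?_
      calc _ ≤ κ⁻¹ * ‖A ν - A μ‖ := by gcongr
        _ < κ⁻¹ * κ := by gcongr
        _ = 1 := inv_mul_cancel₀ hκ.ne'
    have h2 := u.isUnit.mul (isUnit_one_sub_of_norm_lt_one hlt)
    rwa [mul_sub, mul_one, ← mul_assoc, Units.mul_inv, one_mul, hu, sub_sub_cancel] at h2
  have : μ ∈ {μ | IsUnit (A μ)} := by rw [hclopen.eq_univ ⟨μ₀, h₀⟩]; trivial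
  exact this

/-! ### Fourier multipliers on L² -/

noncomputable section Fourier

variable {E : Type*} [NormedAddCommGroup E] [InnerProductSpace ℝ E] [FiniteDimensional ℝ E]
  [MeasurableSpace E] [BorelSpace E]

/-- Locally integrable functions with the same integrals against Schwartz functions agree. -/
theorem ae_eq_of_integral_schwartz_eq {f g : E → ℂ} (hf : LocallyIntegrable f)
    (hg : LocallyIntegrable g) (h : ∀ u : 𝓢(E, ℂ), ∫ x, u x * f x = ∫ x, u x * g x) :
    f =ᵐ[volume] g := by
  refine ae_eq_of_integral_contDiff_smul_eq hf hg fun u hu hc => ?_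
  have h₁ : HasCompactSupport (Complex.ofRealCLM ∘ u) := hc.comp_left rfl
  have h₂ : ContDiff ℝ ((⊤ : ℕ∞) : WithTop ℕ∞) (Complex.ofRealCLM ∘ u) := by fun_prop
  simpa using h (h₁.toSchwartzMap h₂)

theorem locallyIntegrable_Lp_two (f : Lp ℂ 2 (volume : Measure E)) : LocallyIntegrable f :=
  (Lp.memLp f).locallyIntegrable (by norm_num)

/-- The `L²` Fourier transform is self-adjoint against Schwartz functions. -/
theorem integral_schwartz_mul_fourier_Lp (f : Lp ℂ 2 (volume : Measure E)) (u : 𝓢(E, ℂ)) :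
    ∫ x, u x * (𝓕 f : Lp ℂ 2 (volume : Measure E)) x = ∫ x, (𝓕 u) x * f x := by
  have h := congrArg (fun T => T u) (Lp.fourier_toTemperedDistribution_eq f)
  simpa [TemperedDistribution.fourier_apply] using h.symm

theorem integral_mul_fourier_eq_flip {f g : E → ℂ} (hf : Integrable f) (hg : Integrable g) :
    ∫ x, 𝓕 g x * f x = ∫ x, g x * 𝓕 f x := by
  have h := VectorFourier.integral_fourierIntegral_smul_eq_flip (μ := (volume : Measure E))
    (ν := (volume : Measure E)) (L := innerₗ E) (f := g) (g := f) Real.continuous_fourierChar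
    (by simpa using continuous_inner) hg hf
  rw [flip_innerₗ] at h
  exact h

theorem continuous_fourier_of_integrable {f : E → ℂ} (hf : Integrable f) :
    Continuous (𝓕 f : E → ℂ) :=
  VectorFourier.fourierIntegral_continuous Real.continuous_fourierChar
    (by simpa using continuous_inner) hf

/-- On `L¹ ∩ L²` the `L²` Fourier transform is given by the Fourier integral. -/
theorem fourier_toLp_ae_eq {f : E → ℂ} (hf : Integrable f) (hf2 : MemLp f 2) :
    (𝓕 (hf2.toLp f) : Lp ℂ 2 (volume : Measure E)) =ᵐ[volume] 𝓕 f := by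
  refine ae_eq_of_integral_schwartz_eq (locallyIntegrable_Lp_two _)
    (continuous_fourier_of_integrable hf).locallyIntegrable fun u => ?_
  rw [integral_schwartz_mul_fourier_Lp, ← integral_mul_fourier_eq_flip hf u.integrable]
  refine integral_congr_ae ?_
  filter_upwards [hf2.coeFn_toLp] with x hx
  rw [hx, SchwartzMap.fourier_coe]

/-- The Fourier multiplier on `L²` with a bounded continuous symbol. -/
def fourierMultiplierL2 (m : E →ᵇ ℂ) : Lp ℂ 2 (volume : Measure E) →L[ℂ] Lp ℂ 2 (volume : Measure E) :=
  ((Lp.fourierTransformₗᵢ E ℂ).symm.toContinuousLinearEquiv : _ →L[ℂ] _) ∘L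
    (ContinuousLinearMap.mul ℂ ℂ).holderL volume ∞ 2 2 ((m.memLp_top (μ := volume)).toLp m) ∘L
      ((Lp.fourierTransformₗᵢ E ℂ).toContinuousLinearEquiv : _ →L[ℂ] _)

theorem fourier_fourierMultiplierL2 (m : E →ᵇ ℂ) (f : Lp ℂ 2 (volume : Measure E)) :
    (𝓕 (fourierMultiplierL2 m f) : Lp ℂ 2 (volume : Measure E)) =ᵐ[volume]
      fun x => m x * (𝓕 f : Lp ℂ 2 (volume : Measure E)) x := by
  have h : (𝓕 (fourierMultiplierL2 m f) : Lp ℂ 2 (volume : Measure E)) =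
      (ContinuousLinearMap.mul ℂ ℂ).holder 2 ((m.memLp_top (μ := volume)).toLp m) (𝓕 f : Lp ℂ 2 (volume : Measure E)) :=
    (Lp.fourierTransformₗᵢ E ℂ).apply_symm_apply _
  rw [h]
  filter_upwards [(ContinuousLinearMap.mul ℂ ℂ).coeFn_holder (r := 2) ((m.memLp_top (μ := volume)).toLp m)
    (𝓕 f : Lp ℂ 2 (volume : Measure E)), (m.memLp_top (μ := volume)).coeFn_toLp] with x h1 h2
  rw [h1, h2]; rfl

theorem norm_fourierMultiplierL2_sub_le (m m' : E →ᵇ ℂ) :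
    ‖fourierMultiplierL2 m - fourierMultiplierL2 m'‖ ≤ ‖m - m'‖ := by
  refine ContinuousLinearMap.opNorm_le_bound _ (norm_nonneg _) fun f => ?_
  rw [← Lp.norm_fourier_eq, ← Lp.norm_fourier_eq f]
  refine Lp.norm_le_mul_norm_of_ae_le_mul ?_
  rw [_root_.sub_apply, show (𝓕 (fourierMultiplierL2 m f - fourierMultiplierL2 m' f) :
    Lp ℂ 2 (volume : Measure E)) = 𝓕 (fourierMultiplierL2 m f) - 𝓕 (fourierMultiplierL2 m' f) from
      (Lp.fourierTransformₗᵢ E ℂ).map_sub _ _]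
  filter_upwards [fourier_fourierMultiplierL2 m f, fourier_fourierMultiplierL2 m' f,
    Lp.coeFn_sub (𝓕 (fourierMultiplierL2 m f) : Lp ℂ 2 (volume : Measure E))
      (𝓕 (fourierMultiplierL2 m' f))] with x h1 h2 h3
  rw [h3, Pi.sub_apply, h1, h2, ← sub_mul, norm_mul]
  gcongr
  exact (m - m').norm_coe_le_norm x

theorem norm_fourierMultiplierL2_le (m : E →ᵇ ℂ) (f : Lp ℂ 2 (volume : Measure E)) :
    ‖fourierMultiplierL2 m f‖ ≤ ‖m‖ * ‖f‖ := by
  rw [← Lp.norm_fourier_eq, ← Lp.norm_fourier_eq f]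
  refine Lp.norm_le_mul_norm_of_ae_le_mul ?_
  filter_upwards [fourier_fourierMultiplierL2 m f] with x h1
  rw [h1, norm_mul]
  gcongr
  exact m.norm_coe_le_norm x

/-- By Plancherel, a pointwise lower bound on the symbol is a lower bound on the operator. The
Penrose condition enters the estimates through this lemma. -/
theorem le_norm_add_fourierMultiplierL2 {m : E →ᵇ ℂ} {κ : ℝ} (hκ : 0 < κ)
    (hm : ∀ x, κ ≤ ‖1 + m x‖) (f : Lp ℂ 2 (volume : Measure E)) :
    κ * ‖f‖ ≤ ‖f + fourierMultiplierL2 m f‖ := by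
  rw [← Lp.norm_fourier_eq, ← Lp.norm_fourier_eq (f + _), ← le_div_iff₀' hκ, div_eq_inv_mul]
  refine Lp.norm_le_mul_norm_of_ae_le_mul ?_
  rw [FourierTransform.fourier_add]
  filter_upwards [fourier_fourierMultiplierL2 m f,
    Lp.coeFn_add (𝓕 f : Lp ℂ 2 (volume : Measure E)) (𝓕 (fourierMultiplierL2 m f))] with x h1 h3
  rw [h3, Pi.add_apply, h1, ← one_add_mul, norm_mul, ← div_eq_inv_mul, le_div_iff₀' hκ]
  gcongr
  exact hm x

end Fourier

end

/-! ### Causal convolution operators on the half-line -/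

section

open Filter Topology FourierTransform BoundedContinuousFunction

noncomputable section Causal

/-- The Fourier transform of an integrable function as a bounded continuous function. -/
def fourierSymbol (K : ℝ → ℂ) (hK : Integrable K) : ℝ →ᵇ ℂ :=
  BoundedContinuousFunction.ofNormedAddCommGroup (𝓕 K) (continuous_fourier_of_integrable hK)
    (∫ t, ‖K t‖) fun ξ =>
      VectorFourier.norm_fourierIntegral_le_integral_norm Real.fourierChar volume (innerₗ ℝ) K ξ

@[simp]
theorem fourierSymbol_apply {K : ℝ → ℂ} (hK : Integrable K) (ξ : ℝ) :
    fourierSymbol K hK ξ = 𝓕 K ξ := rfl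

theorem norm_fourierSymbol_le {K : ℝ → ℂ} (hK : Integrable K) :
    ‖fourierSymbol K hK‖ ≤ ∫ t, ‖K t‖ :=
  BoundedContinuousFunction.norm_ofNormedAddCommGroup_le _ (integral_nonneg fun _ => norm_nonneg _)
    _

theorem fourierSymbol_sub {K K' : ℝ → ℂ} (hK : Integrable K) (hK' : Integrable K') :
    fourierSymbol K hK - fourierSymbol K' hK' = fourierSymbol (K - K') (hK.sub hK') := by
  ext ξ
  simp only [BoundedContinuousFunction.coe_sub, Pi.sub_apply, fourierSymbol_apply, Real.fourier_eq,
    smul_sub]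
  rw [integral_sub ((Real.fourierIntegral_convergent_iff ξ).2 hK)
    ((Real.fourierIntegral_convergent_iff ξ).2 hK')]

/-- Convolution with an integrable kernel as an operator on `L²(ℝ)`. -/
def convL2 (K : ℝ → ℂ) (hK : Integrable K) :
    Lp ℂ 2 (volume : Measure ℝ) →L[ℂ] Lp ℂ 2 (volume : Measure ℝ) :=
  fourierMultiplierL2 (fourierSymbol K hK)

theorem norm_convL2_apply_le {K : ℝ → ℂ} (hK : Integrable K) (f : Lp ℂ 2 (volume : Measure ℝ)) :
    ‖convL2 K hK f‖ ≤ (∫ t, ‖K t‖) * ‖f‖ :=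
  (norm_fourierMultiplierL2_le _ f).trans (by gcongr; exact norm_fourierSymbol_le hK)

theorem norm_convL2_sub_le {K K' : ℝ → ℂ} (hK : Integrable K) (hK' : Integrable K') :
    ‖convL2 K hK - convL2 K' hK'‖ ≤ ∫ t, ‖K t - K' t‖ := by
  refine (norm_fourierMultiplierL2_sub_le _ _).trans ?_
  rw [fourierSymbol_sub hK hK']
  exact norm_fourierSymbol_le _

-- The convolution is integrable and bounded, hence square integrable.
open scoped Convolution in
theorem memLp_two_convolution {K f : ℝ → ℂ} {B : ℝ} (hK : Integrable K) (hB : ∀ t, ‖K t‖ ≤ B)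
    (hf : Integrable f) : MemLp (K ⋆[ContinuousLinearMap.mul ℂ ℂ] f) 2 := by
  have hint : Integrable (K ⋆[ContinuousLinearMap.mul ℂ ℂ] f) :=
    hK.integrable_convolution (ContinuousLinearMap.mul ℂ ℂ) hf
  have hbd : ∀ t, ‖(K ⋆[ContinuousLinearMap.mul ℂ ℂ] f) t‖ ≤ B * ∫ s, ‖f s‖ := by
    intro t
    rw [convolution_def, ← integral_sub_left_eq_self (fun s => ‖f s‖) volume t,
      ← integral_const_mul]
    refine norm_integral_le_of_norm_le ((hf.comp_sub_left t).norm.const_mul B)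
      (Eventually.of_forall fun s => ?_)
    simp only [ContinuousLinearMap.mul_apply', norm_mul]
    gcongr
    exact hB s
  rw [memLp_two_iff_integrable_sq_norm hint.1]
  simp_rw [pow_two]
  exact hint.norm.bdd_mul hint.1.norm (Eventually.of_forall fun t => by simpa using hbd t)

-- Links the multiplier, defined on all of L², to the actual convolution integral, which is what
-- makes causality visible. For integrable data both Fourier transforms are Fourier integrals and
-- the convolution theorem applies.
open scoped Convolution in
theorem convL2_toLp {K f : ℝ → ℂ} (hK : Integrable K)
    (hf : Integrable f) (hf2 : MemLp f 2) (h2 : MemLp (K ⋆[ContinuousLinearMap.mul ℂ ℂ] f) 2) :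
    convL2 K hK (hf2.toLp f) = h2.toLp _ := by
  have hint : Integrable (K ⋆[ContinuousLinearMap.mul ℂ ℂ] f) :=
    hK.integrable_convolution (ContinuousLinearMap.mul ℂ ℂ) hf
  apply (Lp.fourierTransformₗᵢ ℝ ℂ).injective
  refine Lp.ext ?_
  refine (fourier_fourierMultiplierL2 _ _).trans
    (EventuallyEq.trans ?_ (fourier_toLp_ae_eq hint h2).symm)
  filter_upwards [fourier_toLp_ae_eq hf hf2] with ξ hξ
  rw [hξ, fourierSymbol_apply]
  exact (Real.fourier_mul_convolution_eq hK hf ξ).symm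

/-- The closed subspace of `L²(ℝ)` of functions vanishing before time `T`. -/
def supportedFrom (T : ℝ) : Submodule ℂ (Lp ℂ 2 (volume : Measure ℝ)) :=
  (LpToLpRestrictCLM ℝ ℂ ℂ volume 2 (Iio T)).ker

theorem isClosed_supportedFrom (T : ℝ) :
    IsClosed (supportedFrom T : Set (Lp ℂ 2 (volume : Measure ℝ))) :=
  (LpToLpRestrictCLM ℝ ℂ ℂ volume 2 (Iio T)).isClosed_ker

instance (T : ℝ) : CompleteSpace (supportedFrom T) :=
  (isClosed_supportedFrom T).completeSpace_coe

theorem mem_supportedFrom {T : ℝ} {f : Lp ℂ 2 (volume : Measure ℝ)} :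
    f ∈ supportedFrom T ↔ ∀ᵐ t, t < T → f t = 0 := by
  have h1 : f ∈ supportedFrom T ↔ LpToLpRestrictCLM ℝ ℂ ℂ volume 2 (Iio T) f = 0 := Iff.rfl
  rw [h1, Lp.eq_zero_iff_ae_eq_zero]
  have h2 := LpToLpRestrictCLM_coeFn (F := ℂ) (p := 2) (μ := volume) ℂ (Iio T) f
  have h3 : (∀ᵐ t, t < T → f t = 0) ↔ f =ᵐ[volume.restrict (Iio T)] 0 := by
    rw [EventuallyEq, ae_restrict_iff' measurableSet_Iio]; rfl
  rw [h3]
  exact ⟨fun h => h2.symm.trans h, fun h => h2.trans h⟩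

open scoped Convolution in
/-- Convolution with a kernel supported on positive times is causal. -/
theorem convL2_mem_supportedFrom {K : ℝ → ℂ} {B T : ℝ} (hK : Integrable K) (hB : ∀ t, ‖K t‖ ≤ B)
    (h0 : ∀ t ≤ 0, K t = 0) {f : Lp ℂ 2 (volume : Measure ℝ)} (hf : f ∈ supportedFrom T) :
    convL2 K hK f ∈ supportedFrom T := by
  have hcl : closure (supportedFrom T : Set (Lp ℂ 2 (volume : Measure ℝ))) = supportedFrom T :=
    (isClosed_supportedFrom T).closure_eq
  rw [← SetLike.mem_coe] at hf ⊢
  -- Integrable functions are dense in the subspace: approximate by a compactly supported continuous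
  -- function and cut it off to `[T, ∞)`. The cut-off does not increase the error, since `f`
  -- vanishes before `T`.
  have hsub : (supportedFrom T : Set (Lp ℂ 2 (volume : Measure ℝ))) ⊆
      closure {f | f ∈ supportedFrom T ∧ Integrable f} := by
    intro f hf
    rw [EMetric.mem_closure_iff]
    intro ε hε
    obtain ⟨δ, hδ, hδε⟩ := exists_between hε
    obtain ⟨h, hc, hh, hcont, hh2⟩ := (Lp.memLp f).exists_hasCompactSupport_eLpNorm_sub_le
      (by norm_num) hδ.ne'
    have hh1 : Integrable h := hcont.integrable_of_hasCompactSupport hc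
    have hi2 : MemLp (indicator (Ici T) h) 2 := hh2.indicator measurableSet_Ici
    refine ⟨hi2.toLp _, ⟨?_, ?_⟩, ?_⟩
    · rw [mem_supportedFrom]
      filter_upwards [hi2.coeFn_toLp] with t ht htT
      rw [ht, indicator_of_notMem (by simpa using htT)]
    · exact (integrable_congr hi2.coeFn_toLp).2 (hh1.indicator measurableSet_Ici)
    · refine lt_of_le_of_lt ?_ hδε
      rw [Lp.edist_def]
      refine le_trans (eLpNorm_mono_ae ?_) hh
      rw [SetLike.mem_coe, mem_supportedFrom] at hf
      filter_upwards [hf, hi2.coeFn_toLp] with t ht ht2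
      simp only [Pi.sub_apply, ht2]
      by_cases htT : t < T
      · rw [ht htT, indicator_of_notMem (by simpa using htT)]; simp
      · rw [indicator_of_mem (by simpa using htT)]
  have hmap : MapsTo (convL2 K hK) {f | f ∈ supportedFrom T ∧ Integrable f}
      (supportedFrom T : Set (Lp ℂ 2 (volume : Measure ℝ))) := by
    rintro f ⟨hfT, hf1⟩
    have h2 := memLp_two_convolution hK hB hf1
    have key := convL2_toLp hK hf1 (Lp.memLp f) h2
    rw [Lp.toLp_coeFn] at key
    rw [key, SetLike.mem_coe, mem_supportedFrom]
    rw [mem_supportedFrom] at hfT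
    filter_upwards [h2.coeFn_toLp] with t ht htT
    rw [ht, convolution_def]
    refine integral_eq_zero_of_ae ?_
    have := (quasiMeasurePreserving_sub_left volume t).ae hfT
    filter_upwards [this] with s hs
    by_cases hs0 : s ≤ 0
    · simp [h0 s hs0]
    · simp [hs (by linarith [not_le.1 hs0])]
  have := (hmap.closure (convL2 K hK).continuous) (hsub hf)
  rwa [hcl] at this

/-- The exponentially damped kernel. -/
def dampedKernel (K : ℝ → ℂ) (μ : ℝ≥0) (t : ℝ) : ℂ := (Real.exp (-(μ * t)) : ℂ) * K t

variable {K : ℝ → ℂ}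

theorem dampedKernel_of_nonpos (h0 : ∀ t ≤ 0, K t = 0) (μ : ℝ≥0) (t : ℝ) (ht : t ≤ 0) :
    dampedKernel K μ t = 0 := by simp [dampedKernel, h0 t ht]

theorem norm_dampedKernel_le (h0 : ∀ t ≤ 0, K t = 0) (μ : ℝ≥0) (t : ℝ) :
    ‖dampedKernel K μ t‖ ≤ ‖K t‖ := by
  rcases le_or_gt t 0 with ht | ht
  · simp [dampedKernel_of_nonpos h0 μ t ht]
  · rw [dampedKernel, norm_mul, Complex.norm_real, Real.norm_eq_abs, Real.abs_exp]
    refine mul_le_of_le_one_left (norm_nonneg _) (Real.exp_le_one_iff.2 ?_)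
    have := μ.2
    simp only [Left.neg_nonpos_iff]; positivity

theorem aestronglyMeasurable_dampedKernel (hK : Integrable K) (μ : ℝ≥0) :
    AEStronglyMeasurable (dampedKernel K μ) :=
  (by fun_prop : Continuous fun t : ℝ => (Real.exp (-(μ * t)) : ℂ)).aestronglyMeasurable.mul hK.1

theorem integrable_dampedKernel (hK : Integrable K) (h0 : ∀ t ≤ 0, K t = 0) (μ : ℝ≥0) :
    Integrable (dampedKernel K μ) :=
  hK.mono (aestronglyMeasurable_dampedKernel hK μ)
    (Eventually.of_forall (norm_dampedKernel_le h0 μ))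

theorem tendsto_integral_norm_dampedKernel_atTop (hK : Integrable K) (h0 : ∀ t ≤ 0, K t = 0) :
    Tendsto (fun n : ℕ => ∫ t, ‖dampedKernel K n t‖) atTop (𝓝 0) := by
  have : Tendsto (fun n : ℕ => ∫ t, ‖dampedKernel K n t‖) atTop (𝓝 (∫ _ : ℝ, (0 : ℝ))) := by
    refine tendsto_integral_of_dominated_convergence (fun t => ‖K t‖)
      (fun n => (aestronglyMeasurable_dampedKernel hK _).norm) hK.norm
      (fun n => Eventually.of_forall fun t => by simpa using norm_dampedKernel_le h0 _ t)
      (Eventually.of_forall fun t => ?_)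
    rcases le_or_gt t 0 with ht | ht
    · simp [dampedKernel_of_nonpos h0 _ t ht]
    · have h1 : Tendsto (fun n : ℕ => Real.exp (-(n * t)) * ‖K t‖) atTop (𝓝 (0 * ‖K t‖)) :=
        (Real.tendsto_exp_neg_atTop_nhds_zero.comp
          (tendsto_natCast_atTop_atTop.atTop_mul_const ht)).mul_const _
      rw [zero_mul] at h1
      refine h1.congr fun n => ?_
      rw [dampedKernel, norm_mul, Complex.norm_real, Real.norm_eq_abs, Real.abs_exp]
      simp
  simpa using this

theorem tendsto_integral_norm_dampedKernel_sub (hK : Integrable K) (h0 : ∀ t ≤ 0, K t = 0)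
    (ν : ℝ≥0) :
    Tendsto (fun μ : ℝ≥0 => ∫ t, ‖dampedKernel K μ t - dampedKernel K ν t‖) (𝓝 ν) (𝓝 0) := by
  have : Tendsto (fun μ : ℝ≥0 => ∫ t, ‖dampedKernel K μ t - dampedKernel K ν t‖) (𝓝 ν)
      (𝓝 (∫ _ : ℝ, (0 : ℝ))) := by
    refine tendsto_integral_filter_of_dominated_convergence (fun t => ‖K t‖ + ‖K t‖)
      (Eventually.of_forall fun μ => ((aestronglyMeasurable_dampedKernel hK μ).sub
        (aestronglyMeasurable_dampedKernel hK ν)).norm)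
      (Eventually.of_forall fun μ => Eventually.of_forall fun t => ?_)
      (hK.norm.add hK.norm) (Eventually.of_forall fun t => ?_)
    · rw [norm_norm]
      exact (norm_sub_le _ _).trans
        (add_le_add (norm_dampedKernel_le h0 μ t) (norm_dampedKernel_le h0 ν t))
    · have hc : Continuous fun μ : ℝ≥0 => ‖dampedKernel K μ t - dampedKernel K ν t‖ := by
        unfold dampedKernel; fun_prop
      simpa using hc.tendsto ν
  simpa using this

/-- The operator `1 + K_μ *` on functions vanishing before `T`. -/
def causalOp {B : ℝ} (hK : Integrable K) (hB : ∀ t, ‖K t‖ ≤ B) (h0 : ∀ t ≤ 0, K t = 0) (T : ℝ)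
    (μ : ℝ≥0) : supportedFrom T →L[ℂ] supportedFrom T :=
  1 + (convL2 (dampedKernel K μ) (integrable_dampedKernel hK h0 μ) ∘L
    (supportedFrom T).subtypeL).codRestrict (supportedFrom T) fun f =>
      convL2_mem_supportedFrom _ (fun t => (norm_dampedKernel_le h0 μ t).trans (hB t))
        (dampedKernel_of_nonpos h0 μ) f.2

theorem coe_causalOp {B : ℝ} (hK : Integrable K) (hB : ∀ t, ‖K t‖ ≤ B) (h0 : ∀ t ≤ 0, K t = 0)
    (T : ℝ) (μ : ℝ≥0) (f : supportedFrom T) :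
    (causalOp hK hB h0 T μ f : Lp ℂ 2 (volume : Measure ℝ)) =
      f + convL2 (dampedKernel K μ) (integrable_dampedKernel hK h0 μ) f := rfl

theorem continuous_causalOp {B : ℝ} (hK : Integrable K) (hB : ∀ t, ‖K t‖ ≤ B)
    (h0 : ∀ t ≤ 0, K t = 0) (T : ℝ) : Continuous (causalOp hK hB h0 T) := by
  rw [continuous_iff_continuousAt]
  intro ν
  refine (tendsto_iff_norm_sub_tendsto_zero (E := supportedFrom T →L[ℂ] supportedFrom T)).2
    (squeeze_zero (fun μ => norm_nonneg (causalOp hK hB h0 T μ - causalOp hK hB h0 T ν))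
      (fun μ => ?_)
    (tendsto_integral_norm_dampedKernel_sub hK h0 ν))
  refine ContinuousLinearMap.opNorm_le_bound _ (integral_nonneg fun _ => norm_nonneg _) fun f => ?_
  rw [Submodule.coe_norm, Submodule.coe_norm, _root_.sub_apply, Submodule.coe_sub, coe_causalOp, coe_causalOp,
    add_sub_add_left_eq_sub, ← _root_.sub_apply]
  refine (ContinuousLinearMap.le_opNorm _ _).trans ?_
  gcongr
  exact norm_convL2_sub_le _ _

/-- The symbol of the damped operator samples the Laplace transform on the vertical line of real
part μ, so all μ ≥ 0 together explore the closed right half-plane. -/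
theorem fourier_dampedKernel (h0 : ∀ t ≤ 0, K t = 0) (μ : ℝ≥0) (ξ : ℝ) :
    𝓕 (dampedKernel K μ) ξ =
      ∫ t in Ioi (0 : ℝ), Complex.exp (-(((μ : ℂ) + (2 * π * ξ : ℝ) * Complex.I) * t)) * K t := by
  rw [← integral_indicator measurableSet_Ioi, Real.fourier_eq']
  refine integral_congr_ae (Eventually.of_forall fun t => ?_)
  rcases le_or_gt t 0 with ht | ht
  · simp [dampedKernel_of_nonpos h0 μ t ht, ht]
  · simp only [dampedKernel, smul_eq_mul, indicator_of_mem (mem_Ioi.2 ht)]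
    rw [← mul_assoc, Complex.ofReal_exp, ← Complex.exp_add]
    congr 2
    simp
    ring

/-- A lower bound alone gives no surjectivity on the half-line. It comes from strong damping, where
the kernel has L¹ norm below one, and is transported to μ = 0 by the method of continuity. -/
theorem isUnit_causalOp {B κ : ℝ} (hK : Integrable K) (hB : ∀ t, ‖K t‖ ≤ B)
    (h0 : ∀ t ≤ 0, K t = 0) (hκ : 0 < κ)
    (hlap : ∀ lam : ℂ, 0 ≤ lam.re →
      κ ≤ ‖1 + ∫ t in Ioi (0 : ℝ), Complex.exp (-(lam * t)) * K t‖) (T : ℝ) :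
    IsUnit (causalOp hK hB h0 T 0) := by
  obtain ⟨n, hn⟩ := ((tendsto_integral_norm_dampedKernel_atTop hK h0).eventually_lt_const
    one_pos).exists
  refine isUnit_of_continuous_of_bounded_below (continuous_causalOp hK hB h0 T) hκ
    (fun μ f => ?_) (μ₀ := n) ?_ 0
  · rw [Submodule.coe_norm, Submodule.coe_norm, coe_causalOp]
    refine le_norm_add_fourierMultiplierL2 hκ (fun ξ => ?_) _
    rw [fourierSymbol_apply, fourier_dampedKernel h0]
    exact hlap _ (by simp)
  · rw [← sub_sub_cancel 1 (causalOp hK hB h0 T n)]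
    have hlt : ‖1 - causalOp hK hB h0 T n‖ < 1 := by
      refine lt_of_le_of_lt ?_ hn
      refine ContinuousLinearMap.opNorm_le_bound _ (integral_nonneg fun _ => norm_nonneg _)
        fun f => ?_
      rw [Submodule.coe_norm, Submodule.coe_norm, _root_.sub_apply, one_apply_eq_self,
        Submodule.coe_sub, coe_causalOp, sub_add_cancel_left, norm_neg]
      exact norm_convL2_apply_le _ _
    exact isUnit_one_sub_of_norm_lt_one (R := supportedFrom T →L[ℂ] supportedFrom T) hlt

end Causal

end

/-! ### The unweighted Volterra estimate -/

section

open Filter Topology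

section Volterra

variable {K φ h : ℝ → ℂ} {B T : ℝ}

open scoped Convolution in
theorem convolution_indicator_eq (h0 : ∀ t ≤ 0, K t = 0) (φ : ℝ → ℂ) {t : ℝ}
    (ht : t ∈ Icc 0 T) :
    (K ⋆[ContinuousLinearMap.mul ℂ ℂ] indicator (Icc 0 T) φ) t =
      ∫ s in (0 : ℝ)..t, K (t - s) * φ s := by
  rw [convolution_def, ← integral_sub_left_eq_self _ volume t,
    intervalIntegral.integral_of_le ht.1, ← integral_indicator measurableSet_Ioc]
  refine integral_congr_ae ?_
  filter_upwards [compl_mem_ae_iff.2 (measure_singleton (μ := volume) (0 : ℝ))] with s hs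
  simp only [mem_compl_iff, mem_singleton_iff] at hs
  simp only [sub_sub_cancel, ContinuousLinearMap.mul_apply']
  by_cases h1 : s ∈ Ioc 0 t
  · have h2 : s ∈ Icc 0 T := ⟨h1.1.le, h1.2.trans ht.2⟩
    rw [indicator_of_mem h1, indicator_of_mem h2]
  · rw [indicator_of_notMem h1]
    rcases lt_or_ge t s with h2 | h2
    · rw [h0 _ (by linarith), zero_mul]
    · have h3 : s < 0 := lt_of_le_of_ne (by_contra fun h => h1 ⟨not_le.1 h, h2⟩) hs
      rw [indicator_of_notMem (fun h => absurd h.1 (not_le.2 h3)), mul_zero]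

theorem integrable_indicator_of_memLp (hφ : MemLp φ 2 (volume.restrict (Icc 0 T))) :
    Integrable (indicator (Icc 0 T) φ) :=
  (integrable_indicator_iff measurableSet_Icc).2 (hφ.integrable (by norm_num))

/-- Young's inequality for causal convolution on `[0, T]`. -/
theorem memLp_causal_convolution (hK : Integrable K) (hB : ∀ t, ‖K t‖ ≤ B)
    (h0 : ∀ t ≤ 0, K t = 0) (hφ : MemLp φ 2 (volume.restrict (Icc 0 T))) :
    MemLp (fun t => ∫ s in (0 : ℝ)..t, K (t - s) * φ s) 2 (volume.restrict (Icc 0 T)) ∧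
    eLpNorm (fun t => ∫ s in (0 : ℝ)..t, K (t - s) * φ s) 2 (volume.restrict (Icc 0 T)) ≤
      ENNReal.ofReal (∫ t, ‖K t‖) * eLpNorm φ 2 (volume.restrict (Icc 0 T)) := by
  have hφ1 := integrable_indicator_of_memLp hφ
  have hφ2 := (memLp_indicator_iff_restrict measurableSet_Icc).2 hφ
  have h2 := memLp_two_convolution hK hB hφ1
  have hae : (fun t => ∫ s in (0 : ℝ)..t, K (t - s) * φ s) =ᵐ[volume.restrict (Icc 0 T)]
      convolution K (indicator (Icc 0 T) φ) (ContinuousLinearMap.mul ℂ ℂ) volume := by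
    filter_upwards [ae_restrict_mem measurableSet_Icc] with t ht
    exact (convolution_indicator_eq h0 φ ht).symm
  refine ⟨(memLp_congr_ae hae).2 (h2.restrict _), ?_⟩
  rw [eLpNorm_congr_ae hae]
  refine (eLpNorm_mono_measure _ Measure.restrict_le_self).trans ?_
  have hn := norm_convL2_apply_le hK (hφ2.toLp _)
  rw [convL2_toLp hK hφ1 hφ2 h2, Lp.norm_toLp, Lp.norm_toLp] at hn
  rw [← eLpNorm_indicator_eq_eLpNorm_restrict measurableSet_Icc,
    ← ENNReal.ofReal_toReal h2.2.ne, ← ENNReal.ofReal_toReal hφ2.2.ne,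
    ← ENNReal.ofReal_mul (integral_nonneg fun _ => norm_nonneg _)]
  exact ENNReal.ofReal_le_ofReal hn

/-- Under the Penrose condition the solution of the Volterra equation on `[0, T]` is controlled by
its source, with a constant that does not depend on `T`. -/
theorem eLpNorm_volterra_le {κ : ℝ} (hK : Integrable K) (hB : ∀ t, ‖K t‖ ≤ B)
    (h0 : ∀ t ≤ 0, K t = 0) (hκ : 0 < κ)
    (hlap : ∀ lam : ℂ, 0 ≤ lam.re →
      κ ≤ ‖1 + ∫ t in Ioi (0 : ℝ), Complex.exp (-(lam * t)) * K t‖)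
    (hφ : MemLp φ 2 (volume.restrict (Icc 0 T))) (hh : MemLp h 2 (volume.restrict (Icc 0 T)))
    (heq : ∀ᵐ t ∂(volume.restrict (Icc 0 T)),
      φ t = h t - ∫ s in (0 : ℝ)..t, K (t - s) * φ s) :
    eLpNorm φ 2 (volume.restrict (Icc 0 T)) ≤
      ENNReal.ofReal κ⁻¹ * eLpNorm h 2 (volume.restrict (Icc 0 T)) := by
  have hφ1 := integrable_indicator_of_memLp hφ
  have hφ2 := (memLp_indicator_iff_restrict measurableSet_Icc).2 hφ
  have hh2 := (memLp_indicator_iff_restrict measurableSet_Icc).2 hh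
  have h2 := memLp_two_convolution hK hB hφ1
  set Φ := hφ2.toLp _ with hΦ
  set Η := hh2.toLp _ with hΗ
  have hdamp : dampedKernel K 0 = K := by ext t; simp [dampedKernel]
  have hconv : ∀ f, convL2 (dampedKernel K 0) (integrable_dampedKernel hK h0 0) f =
      convL2 K hK f := by
    intro f; congr 2
  -- The residual of the zero extension: it vanishes for t < 0 by causality and on `[0, T)` by the
  -- equation.
  have hrem : Φ + convL2 K hK Φ - Η ∈ supportedFrom T := by
    rw [hΦ, hΗ, convL2_toLp hK hφ1 hφ2 h2, ← MemLp.toLp_add, ← MemLp.toLp_sub, mem_supportedFrom]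
    rw [ae_restrict_iff' measurableSet_Icc] at heq
    filter_upwards [((hφ2.add h2).sub hh2).coeFn_toLp, heq] with t ht heq htT
    rw [ht]
    simp only [Pi.sub_apply, Pi.add_apply]
    rcases lt_or_ge t 0 with hneg | hpos
    · have h1 : t ∉ Icc 0 T := fun h => absurd h.1 (not_le.2 hneg)
      rw [indicator_of_notMem h1, indicator_of_notMem h1, convolution_def, sub_zero, zero_add]
      refine integral_eq_zero_of_ae (Eventually.of_forall fun s => ?_)
      rcases le_or_gt s 0 with hs | hs
      · simp [h0 s hs]
      · have h2 : t - s ∉ Icc 0 T := fun h => by linarith [h.1]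
        simp [indicator_of_notMem h2]
    · have h1 : t ∈ Icc 0 T := ⟨hpos, htT.le⟩
      rw [convolution_indicator_eq h0 φ h1, indicator_of_mem h1, indicator_of_mem h1, heq h1]
      ring
  -- Correct Φ by a function `u` living after time `T` that absorbs the residual, so that Φ - u
  -- solves the equation on the whole line.
  obtain ⟨w, hw⟩ := isUnit_causalOp hK hB h0 hκ hlap T
  set u : supportedFrom T := (↑w⁻¹ : supportedFrom T →L[ℂ] supportedFrom T) ⟨_, hrem⟩ with hu
  have hu2 : causalOp hK hB h0 T 0 u = ⟨_, hrem⟩ := by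
    rw [hu, ← hw, ← mul_apply_eq_comp, Units.mul_inv, one_apply_eq_self]
  have hu3 : (u : Lp ℂ 2 (volume : Measure ℝ)) + convL2 K hK u = Φ + convL2 K hK Φ - Η := by
    rw [← hconv, ← coe_causalOp hK hB h0 T 0 u, hu2]
  have hu4 : (Φ - u) + convL2 K hK (Φ - u) = Η := by
    have h3 : (Φ - u) + convL2 K hK (Φ - u) =
        (Φ + convL2 K hK Φ) - ((u : Lp ℂ 2 (volume : Measure ℝ)) + convL2 K hK u) := by
      rw [map_sub]; abel
    rw [h3, hu3, sub_sub_cancel]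
  have hlow : κ * ‖Φ - u‖ ≤ ‖Η‖ := by
    rw [← hu4]
    refine le_norm_add_fourierMultiplierL2 hκ (fun ξ => ?_) _
    rw [fourierSymbol_apply]
    have h3 := fourier_dampedKernel h0 0 ξ
    rw [hdamp] at h3
    rw [h3]
    exact hlap _ (by simp)
  -- Before `T` the correction `u` vanishes, and after `T` the function Φ does, so subtracting `u`
  -- can only increase the norm.
  have hmono : ‖Φ‖ ≤ ‖Φ - u‖ := by
    refine Lp.norm_le_norm_of_ae_le ?_
    have h3 := mem_supportedFrom.1 u.2
    filter_upwards [h3, Lp.coeFn_sub Φ (u : Lp ℂ 2 (volume : Measure ℝ)), hφ2.coeFn_toLp,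
      compl_mem_ae_iff.2 (measure_singleton (μ := volume) T)] with t h4 h5 h6 h7
    rw [h5, Pi.sub_apply]
    rcases lt_or_ge t T with htT | htT
    · rw [h4 htT, sub_zero]
    · have h8 : t ∉ Icc 0 T := fun h => h7 (le_antisymm h.2 htT)
      rw [hΦ, h6, indicator_of_notMem h8, norm_zero]
      exact norm_nonneg _
  have hfin : ‖Φ‖ ≤ κ⁻¹ * ‖Η‖ := by
    rw [inv_mul_eq_div, le_div_iff₀' hκ]
    exact (mul_le_mul_of_nonneg_left hmono hκ.le).trans hlow
  rw [hΦ, hΗ, Lp.norm_toLp, Lp.norm_toLp] at hfin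
  rw [← eLpNorm_indicator_eq_eLpNorm_restrict measurableSet_Icc,
    ← eLpNorm_indicator_eq_eLpNorm_restrict measurableSet_Icc,
    ← ENNReal.ofReal_toReal hφ2.2.ne, ← ENNReal.ofReal_toReal hh2.2.ne,
    ← ENNReal.ofReal_mul (by positivity)]
  exact ENNReal.ofReal_le_ofReal hfin

/-- An integrable solution of the Volterra equation with square integrable source and bounded kernel
is square integrable. -/
theorem memLp_two_of_volterra (hB : ∀ t, ‖K t‖ ≤ B)
    (hφ : IntegrableOn φ (Icc 0 T)) (hh : MemLp h 2 (volume.restrict (Icc 0 T)))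
    (heq : ∀ᵐ t ∂(volume.restrict (Icc 0 T)),
      φ t = h t - ∫ s in (0 : ℝ)..t, K (t - s) * φ s) :
    MemLp φ 2 (volume.restrict (Icc 0 T)) := by
  have hB0 : 0 ≤ B := (norm_nonneg _).trans (hB 0)
  -- The difference is the Volterra integral, which is bounded because the kernel is bounded and φ
  -- is integrable.
  have hdiff : MemLp (fun t => h t - φ t) 2 (volume.restrict (Icc 0 T)) := by
    refine MemLp.of_bound (hh.1.sub hφ.1) (B * ∫ s in Icc 0 T, ‖φ s‖) ?_
    filter_upwards [heq, ae_restrict_mem measurableSet_Icc] with t h1 ht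
    rw [show h t - φ t = ∫ s in (0 : ℝ)..t, K (t - s) * φ s by rw [h1]; ring,
      intervalIntegral.integral_of_le ht.1, ← integral_const_mul]
    have hsub : Ioc 0 t ⊆ Icc 0 T := fun s hs => ⟨hs.1.le, hs.2.trans ht.2⟩
    refine (norm_integral_le_of_norm_le ((hφ.mono_set hsub).norm.const_mul B)
      (Eventually.of_forall fun s => ?_)).trans
      (setIntegral_mono_set (hφ.norm.const_mul B) (Eventually.of_forall fun s => by positivity)
        hsub.eventuallyLE)
    rw [norm_mul]
    gcongr
    exact hB _
  refine (memLp_congr_ae (Eventually.of_forall fun t => ?_)).1 (hh.sub hdiff)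
  simp

end Volterra

end

/-! ### Polynomial weights in time -/

section

open Filter Topology

noncomputable section Weighted

/-- The kernel `(a t)^j K(t)` truncated to times in `(0, T]`. -/
def momentKernel (K : ℝ → ℂ) (a T : ℝ) (j : ℕ) : ℝ → ℂ :=
  indicator (Ioc 0 T) fun t => (((a * t) ^ j : ℝ) : ℂ) * K t

variable {K φ h : ℝ → ℂ} {a B T : ℝ}

theorem momentKernel_of_nonpos (j : ℕ) {t : ℝ} (ht : t ≤ 0) : momentKernel K a T j t = 0 :=
  indicator_of_notMem (fun h => absurd h.1 (not_lt.2 ht)) _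

theorem norm_momentKernel_le (ha : 0 ≤ a) (j : ℕ) (t : ℝ) :
    ‖momentKernel K a T j t‖ ≤ indicator (Ioi 0) (fun t => (a * t) ^ j * ‖K t‖) t := by
  by_cases ht : t ∈ Ioc 0 T
  · have h0 : 0 ≤ t := ht.1.le
    rw [momentKernel, indicator_of_mem ht, indicator_of_mem (mem_Ioi.2 ht.1), norm_mul,
      Complex.norm_real, Real.norm_of_nonneg (by positivity)]
  · rw [momentKernel, indicator_of_notMem ht, norm_zero]
    exact indicator_nonneg (fun s hs => by have := (mem_Ioi.1 hs).le; positivity) _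

theorem norm_momentKernel_le_const (ha : 0 ≤ a) (hT : 0 ≤ T) (hB : ∀ t, ‖K t‖ ≤ B) (j : ℕ)
    (t : ℝ) : ‖momentKernel K a T j t‖ ≤ (a * T) ^ j * B := by
  have hB0 : 0 ≤ B := (norm_nonneg _).trans (hB 0)
  by_cases ht : t ∈ Ioc 0 T
  · have h0 : 0 ≤ t := ht.1.le
    rw [momentKernel, indicator_of_mem ht, norm_mul, Complex.norm_real,
      Real.norm_of_nonneg (by positivity)]
    gcongr
    exacts [ht.2, hB t]
  · rw [momentKernel, indicator_of_notMem ht, norm_zero]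
    positivity

theorem aestronglyMeasurable_momentKernel (hK : AEStronglyMeasurable K) (j : ℕ) :
    AEStronglyMeasurable (momentKernel K a T j) :=
  ((by fun_prop : Continuous fun t : ℝ => (((a * t) ^ j : ℝ) : ℂ)).aestronglyMeasurable.mul
    hK).indicator measurableSet_Ioc

theorem integrable_momentKernel (ha : 0 ≤ a) (hK : AEStronglyMeasurable K) {j : ℕ}
    (hj : IntegrableOn (fun t => (a * t) ^ j * ‖K t‖) (Ioi 0)) :
    Integrable (momentKernel K a T j) :=
  ((integrable_indicator_iff measurableSet_Ioi).2 hj).mono'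
    (aestronglyMeasurable_momentKernel hK j) (Eventually.of_forall (norm_momentKernel_le ha j))

theorem integral_norm_momentKernel_le (ha : 0 ≤ a) (hK : AEStronglyMeasurable K) {j : ℕ}
    (hj : IntegrableOn (fun t => (a * t) ^ j * ‖K t‖) (Ioi 0)) :
    ∫ t, ‖momentKernel K a T j t‖ ≤ ∫ t in Ioi 0, (a * t) ^ j * ‖K t‖ := by
  rw [← integral_indicator measurableSet_Ioi]
  exact integral_mono (integrable_momentKernel ha hK hj).norm
    ((integrable_indicator_iff measurableSet_Ioi).2 hj) (norm_momentKernel_le ha j)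

theorem memLp_pow_mul (hφ : MemLp φ 2 (volume.restrict (Icc 0 T))) (ha : 0 ≤ a) (i : ℕ) :
    MemLp (fun t => (((a * t) ^ i : ℝ) : ℂ) * φ t) 2 (volume.restrict (Icc 0 T)) := by
  refine hφ.of_le_mul (c := (a * T) ^ i)
    ((by fun_prop : Continuous fun t : ℝ =>
      (((a * t) ^ i : ℝ) : ℂ)).aestronglyMeasurable.mul hφ.1) ?_
  filter_upwards [ae_restrict_mem measurableSet_Icc] with t ht
  have := ht.1
  rw [norm_mul, Complex.norm_real, Real.norm_of_nonneg (by positivity)]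
  gcongr
  exact ht.2

theorem intervalIntegrable_momentKernel_mul (ha : 0 ≤ a) (hB : ∀ t, ‖K t‖ ≤ B)
    (hK : AEStronglyMeasurable K) (hφ : MemLp φ 2 (volume.restrict (Icc 0 T))) (j : ℕ) {t : ℝ}
    (ht : t ∈ Icc 0 T) :
    IntervalIntegrable (fun s => momentKernel K a T j (t - s) * φ s) volume 0 t := by
  rw [intervalIntegrable_iff_integrableOn_Ioc_of_le ht.1]
  have hφ1 : IntegrableOn φ (Icc 0 T) := hφ.integrable (by norm_num)
  refine Integrable.bdd_mul (c := (a * T) ^ j * B)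
    (hφ1.mono_set fun s hs => ⟨hs.1.le, hs.2.trans ht.2⟩) ?_
    (Eventually.of_forall fun s => norm_momentKernel_le_const ha (ht.1.trans ht.2) hB j _)
  exact ((aestronglyMeasurable_momentKernel hK j).comp_quasiMeasurePreserving
    (quasiMeasurePreserving_sub_left volume t)).restrict

/-- Binomial expansion of (a(t - s) + as)^i under the integral. The top power of `s` reproduces the
original operator; every other term has a strictly lower power on φ. -/
theorem pow_mul_volterra (ha : 0 ≤ a) (hB : ∀ t, ‖K t‖ ≤ B) (h0 : ∀ t ≤ 0, K t = 0)
    (hK : AEStronglyMeasurable K) (hφ : MemLp φ 2 (volume.restrict (Icc 0 T))) (i : ℕ) {t : ℝ}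
    (ht : t ∈ Icc 0 T) :
    (((a * t) ^ i : ℝ) : ℂ) * ∫ s in (0 : ℝ)..t, K (t - s) * φ s =
      (∫ s in (0 : ℝ)..t, K (t - s) * ((((a * s) ^ i : ℝ) : ℂ) * φ s)) +
      ∑ l ∈ Finset.range i, (i.choose l : ℂ) *
        ∫ s in (0 : ℝ)..t, momentKernel K a T (i - l) (t - s) *
          ((((a * s) ^ l : ℝ) : ℂ) * φ s) := by
  have hint : ∀ j l, IntervalIntegrable (fun s => momentKernel K a T j (t - s) *
      ((((a * s) ^ l : ℝ) : ℂ) * φ s)) volume 0 t := fun j l =>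
    intervalIntegrable_momentKernel_mul ha hB hK (memLp_pow_mul hφ ha l) j ht
  have hlast : (∫ s in (0 : ℝ)..t, K (t - s) * ((((a * s) ^ i : ℝ) : ℂ) * φ s)) =
      (i.choose i : ℂ) * ∫ s in (0 : ℝ)..t, momentKernel K a T (i - i) (t - s) *
          ((((a * s) ^ i : ℝ) : ℂ) * φ s) := by
    rw [Nat.choose_self, Nat.cast_one, one_mul]
    refine intervalIntegral.integral_congr fun s hs => ?_
    rw [uIcc_of_le ht.1] at hs
    congr 1
    by_cases h1 : t - s ∈ Ioc 0 T
    · simp [momentKernel, indicator_of_mem h1]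
    · rw [momentKernel, indicator_of_notMem h1]
      refine h0 _ (by_contra fun h => h1 ⟨not_le.1 h, ?_⟩)
      linarith [hs.1, ht.2]
  rw [hlast, add_comm, ← Finset.sum_range_succ (fun l => (i.choose l : ℂ) *
        ∫ s in (0 : ℝ)..t, momentKernel K a T (i - l) (t - s) *
          ((((a * s) ^ l : ℝ) : ℂ) * φ s))]
  simp_rw [← intervalIntegral.integral_const_mul]
  rw [← intervalIntegral.integral_finsetSum fun l _ => (hint (i - l) l).const_mul _]
  refine intervalIntegral.integral_congr fun s hs => ?_
  rw [uIcc_of_le ht.1] at hs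
  by_cases h1 : t - s ∈ Ioc 0 T
  · simp_rw [momentKernel, indicator_of_mem h1]
    have h2 : (a * t) ^ i = ∑ l ∈ Finset.range (i + 1),
        (a * s) ^ l * (a * (t - s)) ^ (i - l) * (i.choose l : ℝ) := by
      rw [← add_pow]; ring
    rw [h2, Complex.ofReal_sum, Finset.sum_mul]
    refine Finset.sum_congr rfl fun l _ => ?_
    push_cast
    ring
  · have h2 : K (t - s) = 0 := h0 _ (by_contra fun h => h1 ⟨not_le.1 h, by linarith [hs.1, ht.2]⟩)
    rw [h2]
    simp_rw [momentKernel, indicator_of_notMem h1]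
    simp

/-- Polynomially weighted estimates for the Volterra equation. -/
theorem exists_weighted_volterra_bound {κ : ℝ} (hκ : 0 < κ) (L : ℝ≥0) (i : ℕ) :
    ∃ D : ℝ≥0, ∀ (K φ h : ℝ → ℂ) (a B T : ℝ) (N : ℝ≥0∞), 0 ≤ a →
      Integrable K → (∀ t, ‖K t‖ ≤ B) → (∀ t ≤ 0, K t = 0) →
      (∀ lam : ℂ, 0 ≤ lam.re →
        κ ≤ ‖1 + ∫ t in Ioi (0 : ℝ), Complex.exp (-(lam * t)) * K t‖) →
      (∀ j ≤ i, IntegrableOn (fun t => (a * t) ^ j * ‖K t‖) (Ioi 0)) →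
      (∀ j ≤ i, ∫ t in Ioi 0, (a * t) ^ j * ‖K t‖ ≤ L) →
      MemLp φ 2 (volume.restrict (Icc 0 T)) → MemLp h 2 (volume.restrict (Icc 0 T)) →
      (∀ᵐ t ∂(volume.restrict (Icc 0 T)),
        φ t = h t - ∫ s in (0 : ℝ)..t, K (t - s) * φ s) →
      (∀ j ≤ i, eLpNorm (fun t => (((a * t) ^ j : ℝ) : ℂ) * h t) 2
        (volume.restrict (Icc 0 T)) ≤ N) →
      eLpNorm (fun t => (((a * t) ^ i : ℝ) : ℂ) * φ t) 2 (volume.restrict (Icc 0 T)) ≤ D * N := by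
  induction i using Nat.strong_induction_on with
  | _ i ih =>
  choose! D hD using ih
  -- The 1 accounts for the source. The l-th remainder has a kernel of L¹ norm at most `L` acting on
  -- the l-th weighted solution, which is bounded by `D l` by induction.
  refine ⟨(κ⁻¹).toNNReal * (1 + ∑ l ∈ Finset.range i, (i.choose l : ℝ≥0) * (L * D l)), ?_⟩
  intro K φ h a B T N ha hK hB h0 hlap hint hL hφ hh heq hN
  set μ := volume.restrict (Icc (0 : ℝ) T)
  set R : ℕ → ℝ → ℂ := fun l t => (i.choose l : ℂ) *
    ∫ s in (0 : ℝ)..t, momentKernel K a T (i - l) (t - s) * ((((a * s) ^ l : ℝ) : ℂ) * φ s)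
    with hR
  have hRl : ∀ l ∈ Finset.range i, MemLp (R l) 2 μ ∧
      eLpNorm (R l) 2 μ ≤ ((i.choose l : ℝ≥0) * (L * D l) : ℝ≥0) * N := by
    intro l hl
    have hli := Finset.mem_range.1 hl
    -- For T < 0 the interval is empty; the pointwise bound on the moment kernels needs 0 ≤ T.
    rcases lt_or_ge T 0 with hT | hT
    · have : μ = 0 := by simp [μ, Icc_eq_empty (not_le.2 hT)]
      rw [this]; simp
    obtain ⟨h1, h2⟩ := memLp_causal_convolution
      (integrable_momentKernel ha hK.1 (hint (i - l) (Nat.sub_le _ _)))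
      (norm_momentKernel_le_const ha hT hB (i - l))
      (fun t ht => momentKernel_of_nonpos (i - l) ht) (memLp_pow_mul (T := T) hφ ha l)
    refine ⟨h1.const_mul _, ?_⟩
    have h3 : R l = (i.choose l : ℂ) • fun t => ∫ s in (0 : ℝ)..t,
      momentKernel K a T (i - l) (t - s) * ((((a * s) ^ l : ℝ) : ℂ) * φ s) := rfl
    have h4 := hD l hli K φ h a B T N ha hK hB h0 hlap (fun j hj => hint j (hj.trans hli.le))
      (fun j hj => hL j (hj.trans hli.le)) hφ hh heq (fun j hj => hN j (hj.trans hli.le))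
    have h5 : ENNReal.ofReal (∫ t, ‖momentKernel K a T (i - l) t‖) ≤ L := by
      rw [← ENNReal.ofReal_coe_nnreal]
      exact ENNReal.ofReal_le_ofReal ((integral_norm_momentKernel_le ha hK.1
        (hint _ (Nat.sub_le _ _))).trans (hL _ (Nat.sub_le _ _)))
    rw [h3, eLpNorm_const_smul]
    calc _ ≤ ‖(i.choose l : ℂ)‖ₑ * (L * (D l * N)) := by
          gcongr
          exact h2.trans (mul_le_mul' h5 h4)
      _ = _ := by
          have : ‖(i.choose l : ℂ)‖ₑ = ((i.choose l : ℝ≥0) : ℝ≥0∞) := by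
            rw [← ofReal_norm, Complex.norm_natCast, ENNReal.ofReal_natCast, ENNReal.coe_natCast]
          rw [this]
          push_cast
          ring
  have hsum : MemLp (∑ l ∈ Finset.range i, R l) 2 μ := memLp_finsetSum' _ fun l hl => (hRl l hl).1
  have hhi := memLp_pow_mul hh ha i
  -- The weighted solution solves the same Volterra equation, with the remainders moved into the
  -- source.
  have hmain := eLpNorm_volterra_le hK hB h0 hκ hlap (memLp_pow_mul hφ ha i) (hhi.sub hsum) (by
    filter_upwards [heq, ae_restrict_mem measurableSet_Icc] with t h1 ht
    have h2 := pow_mul_volterra ha hB h0 hK.1 hφ i ht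
    rw [Pi.sub_apply, Finset.sum_apply]
    nth_rewrite 1 [h1]
    rw [mul_sub, h2]
    ring)
  refine hmain.trans ?_
  have h6 : ENNReal.ofReal κ⁻¹ = ((κ⁻¹).toNNReal : ℝ≥0∞) := rfl
  rw [h6, ENNReal.coe_mul, mul_assoc]
  gcongr
  refine (eLpNorm_sub_le hhi.1 hsum.1 (by norm_num)).trans ?_
  rw [ENNReal.coe_add, add_mul, ENNReal.coe_one, one_mul, ENNReal.ofNNReal_finsetSum,
    Finset.sum_mul]
  refine add_le_add (hN i le_rfl) ?_
  refine (eLpNorm_sum_le (fun l hl => (hRl l hl).1.1) (by norm_num)).trans ?_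
  exact Finset.sum_le_sum fun l hl => (hRl l hl).2

end Weighted

end

/-! ### Sobolev regularity of negative powers of 1 + |x|² -/

section

open Filter Topology FourierTransform SchwartzMap LineDeriv Laplacian TemperedDistribution
open Module (finrank)

noncomputable section BesselWeight

variable {E : Type*} [NormedAddCommGroup E]

/-- The function `(1 + ‖x‖²)^(-a)`, as a complex function. -/
def besselWeight (E : Type*) [NormedAddCommGroup E] (a : ℝ) (x : E) : ℂ :=
  ((1 + ‖x‖ ^ 2) ^ (-a) : ℝ)

/-- Absorbs the factor |x|² produced by two derivatives, so that the Laplacian stays in the span of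
this family. -/
theorem norm_sq_mul_besselWeight (a : ℝ) (x : E) :
    ((‖x‖ ^ 2 : ℝ) : ℂ) * besselWeight E (a + 1) x =
      besselWeight E a x - besselWeight E (a + 1) x := by
  have h : (1 + ‖x‖ ^ 2) ^ (-a) = (1 + ‖x‖ ^ 2) * (1 + ‖x‖ ^ 2) ^ (-(a + 1)) := by
    have h1 : (0 : ℝ) < 1 + ‖x‖ ^ 2 := by positivity
    rw [show -a = 1 + -(a + 1) by ring, rpow_add h1, rpow_one]
  simp only [besselWeight]
  rw [h]
  push_cast
  ring

variable [InnerProductSpace ℝ E]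

@[fun_prop]
theorem hasTemperateGrowth_besselWeight (a : ℝ) : (besselWeight E a).HasTemperateGrowth := by
  unfold besselWeight; fun_prop

theorem hasFDerivAt_one_add_norm_sq_rpow (a : ℝ) (x : E) :
    HasFDerivAt (fun y : E => (1 + ‖y‖ ^ 2) ^ (-a))
      ((-a * (1 + ‖x‖ ^ 2) ^ (-a - 1)) • (2 • innerSL ℝ x)) x := by
  have h1 : HasFDerivAt (fun y : E => 1 + ‖y‖ ^ 2) (2 • innerSL ℝ x) x :=
    (hasStrictFDerivAt_norm_sq x).hasFDerivAt.const_add 1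
  exact h1.rpow_const (Or.inl (by positivity))

theorem fderiv_besselWeight (a : ℝ) (x m : E) :
    fderiv ℝ (besselWeight E a) x m = -2 * a * (inner ℝ x m : ℝ) * besselWeight E (a + 1) x := by
  have h1 := (Complex.ofRealCLM.hasFDerivAt.comp x (hasFDerivAt_one_add_norm_sq_rpow a x)).fderiv
  have h2 : besselWeight E a = Complex.ofRealCLM ∘ fun y : E => (1 + ‖y‖ ^ 2) ^ (-a) := rfl
  rw [h2, h1]
  rw [show -a - 1 = -(a + 1) by ring]
  simp [besselWeight]
  ring

theorem fderiv_inner_mul_besselWeight (a : ℝ) (x m : E) :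
    fderiv ℝ (fun y : E => ((inner ℝ y m : ℝ) : ℂ) * besselWeight E a y) x m =
      (‖m‖ ^ 2 : ℝ) * besselWeight E a x -
        2 * a * ((inner ℝ x m : ℝ) : ℂ) ^ 2 * besselWeight E (a + 1) x := by
  have h1 : HasFDerivAt (fun y : E => ((inner ℝ y m : ℝ) : ℂ))
      (Complex.ofRealCLM ∘L innerSL ℝ m) x := by
    have := (Complex.ofRealCLM ∘L innerSL ℝ m).hasFDerivAt (x := x)
    refine this.congr_of_eventuallyEq (Eventually.of_forall fun y => ?_)
    simp [real_inner_comm]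
  have h2 : DifferentiableAt ℝ (besselWeight E a) x :=
    ((hasTemperateGrowth_besselWeight (E := E) a).1.differentiable (by simp)).differentiableAt
  rw [HasFDerivAt.fderiv (f := fun y : E => ((inner ℝ y m : ℝ) : ℂ) * besselWeight E a y)
    (h1.mul h2.hasFDerivAt)]
  simp [fderiv_besselWeight]
  ring

variable [FiniteDimensional ℝ E] [MeasurableSpace E] [BorelSpace E]

theorem integrable_schwartz_mul (u : 𝓢(E, ℂ)) {f : E → ℂ} (hf : f.HasTemperateGrowth) :
    Integrable fun x => f x * u x :=
  (SchwartzMap.smulLeftCLM ℂ f u).integrable.congr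
    (Eventually.of_forall fun x => by simp [SchwartzMap.smulLeftCLM_apply_apply hf])

theorem integral_mul_lineDeriv_schwartz {f : E → ℂ} (m : E) (hf : f.HasTemperateGrowth)
    (hf' : (fun x => fderiv ℝ f x m).HasTemperateGrowth) (u : 𝓢(E, ℂ)) :
    ∫ x, f x * (∂_{m} u) x = - ∫ x, fderiv ℝ f x m * u x :=
  integral_mul_fderiv_eq_neg_fderiv_mul_of_integrable (integrable_schwartz_mul u hf')
    (integrable_schwartz_mul (∂_{m} u) hf) (integrable_schwartz_mul u hf)
    (fun _ _ => (hf.1.differentiable (by simp)).differentiableAt) (fun _ _ => u.differentiableAt)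

theorem integral_besselWeight_mul_laplacian (a : ℝ) (u : 𝓢(E, ℂ)) :
    ∫ x, besselWeight E a x * (Δ u) x =
      ∫ x, (-2 * a * (finrank ℝ E * besselWeight E (a + 1) x -
        2 * (a + 1) * (besselWeight E (a + 1) x - besselWeight E (a + 2) x))) * u x := by
  set b := stdOrthonormalBasis ℝ E
  have hm : ∀ m : E, ‖m‖ = 1 → ∫ x, besselWeight E a x * (∂_{m} (∂_{m} u)) x =
      ∫ x, (-2 * a * (besselWeight E (a + 1) x -
        2 * (a + 1) * ((inner ℝ x m : ℝ) : ℂ) ^ 2 * besselWeight E (a + 2) x)) * u x := by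
    intro m hm
    have h1 : (fun x => fderiv ℝ (besselWeight E a) x m) =
        fun x => (-2 * a : ℂ) * (((inner ℝ x m : ℝ) : ℂ) * besselWeight E (a + 1) x) := by
      ext x; rw [fderiv_besselWeight]; ring
    have h2 : (fun x => fderiv ℝ (fun y : E => ((inner ℝ y m : ℝ) : ℂ) *
        besselWeight E (a + 1) y) x m) = fun x => besselWeight E (a + 1) x -
        2 * (a + 1) * ((inner ℝ x m : ℝ) : ℂ) ^ 2 * besselWeight E (a + 2) x := by
      ext x
      rw [fderiv_inner_mul_besselWeight, hm, show a + 1 + 1 = a + 2 by ring]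
      push_cast
      ring
    rw [integral_mul_lineDeriv_schwartz m (by fun_prop) (by rw [h1]; fun_prop)]
    simp_rw [fun x => congrFun h1 x, mul_assoc (-2 * a : ℂ)]
    rw [integral_const_mul, integral_const_mul,
      integral_mul_lineDeriv_schwartz m (by fun_prop) (by rw [h2]; fun_prop)]
    simp_rw [fun x => congrFun h2 x]
    ring
  rw [SchwartzMap.laplacian_eq_sum b]
  have h3 : ∀ x, besselWeight E a x * (∑ i, ∂_{b i} (∂_{b i} u)) x =
      ∑ i, besselWeight E a x * (∂_{b i} (∂_{b i} u)) x := by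
    intro x; rw [_root_.sum_apply, Finset.mul_sum]
  simp_rw [h3]
  rw [integral_finsetSum _ fun i _ => integrable_schwartz_mul _ (by fun_prop)]
  simp_rw [fun i => hm (b i) (b.norm_eq_one i)]
  rw [← integral_finsetSum _ fun i _ => integrable_schwartz_mul u (by fun_prop)]
  congr 1 with x
  rw [← Finset.sum_mul, ← Finset.mul_sum, Finset.sum_sub_distrib, ← Finset.sum_mul,
    ← Finset.mul_sum]
  have h4 : ∑ i, ((inner ℝ x (b i) : ℝ) : ℂ) ^ 2 = ((‖x‖ ^ 2 : ℝ) : ℂ) := by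
    rw [← b.sum_sq_inner_left x]; push_cast; rfl
  have h5 := norm_sq_mul_besselWeight (a + 1) x
  rw [show a + 1 + 1 = a + 2 by ring] at h5
  rw [h4, mul_assoc _ _ (besselWeight E (a + 2) x), h5]
  simp

theorem memLp_two_besselWeight {a : ℝ} (ha : (finrank ℝ E : ℝ) < 4 * a) :
    MemLp (besselWeight E a) 2 := by
  rw [memLp_two_iff_integrable_sq_norm
    (hasTemperateGrowth_besselWeight a).1.continuous.aestronglyMeasurable]
  refine (integrable_rpow_neg_one_add_norm_sq ha).congr (Eventually.of_forall fun x => ?_)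
  simp only [besselWeight]
  rw [Complex.norm_real, Real.norm_of_nonneg (by positivity), ← rpow_mul_natCast (by positivity)]
  congr 1
  push_cast
  ring

/-- In this normalisation Δ has symbol -4π²|x|², so the potential of order two is 1 - Δ/4π². -/
theorem besselPotential_two_eq (f : 𝓢'(E, ℂ)) :
    besselPotential E ℂ 2 f = f + (-(((2 * π) ^ 2 : ℝ) : ℂ)⁻¹) • Δ f := by
  have h1 : (fun x : E => (((1 + ‖x‖ ^ 2) ^ ((2 : ℝ) / 2) : ℝ) : ℂ)) =
      (fun _ => (1 : ℂ)) + fun x : E => ((‖x‖ ^ 2 : ℝ) : ℂ) := by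
    ext x; simp
  have hc : (((2 * π) ^ 2 : ℝ) : ℂ) ≠ 0 := by
    exact_mod_cast (by positivity : ((2 * π) ^ 2 : ℝ) ≠ 0)
  rw [TemperedDistribution.laplacian_eq_fourierMultiplierCLM, besselPotential, h1,
    TemperedDistribution.fourierMultiplierCLM_apply,
    TemperedDistribution.fourierMultiplierCLM_apply, TemperedDistribution.smulLeftCLM_add (by fun_prop) (by fun_prop),
    ← Complex.coe_smul (-(2 * π) ^ 2), smul_smul, add_apply, fourierInv_add]
  congr 1
  · simp
  · rw [Complex.ofReal_neg, neg_mul_neg, inv_mul_cancel₀ hc, one_smul]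

theorem laplacian_besselWeight {a : ℝ} (ha : (finrank ℝ E : ℝ) < 4 * a)
    (h1 : (finrank ℝ E : ℝ) < 4 * (a + 1)) (h2 : (finrank ℝ E : ℝ) < 4 * (a + 2)) :
    Δ (Lp.toTemperedDistribution ((memLp_two_besselWeight ha).toLp _)) =
      (-2 * a * (finrank ℝ E - 2 * (a + 1)) : ℂ) •
        Lp.toTemperedDistribution ((memLp_two_besselWeight h1).toLp _) +
      (-2 * a * (2 * (a + 1)) : ℂ) •
        Lp.toTemperedDistribution ((memLp_two_besselWeight h2).toLp _) := by
  have key : ∀ {c : ℝ} (hc : (finrank ℝ E : ℝ) < 4 * c) (u : 𝓢(E, ℂ)),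
      Lp.toTemperedDistribution ((memLp_two_besselWeight hc).toLp _) u =
        ∫ x, besselWeight E c x * u x := by
    intro c hc u
    rw [Lp.toTemperedDistribution_apply]
    refine integral_congr_ae ?_
    filter_upwards [(memLp_two_besselWeight hc).coeFn_toLp] with x hx
    rw [hx, smul_eq_mul, mul_comm]
  ext u
  rw [laplacian_apply_apply, key ha, integral_besselWeight_mul_laplacian, _root_.add_apply,
    _root_.smul_apply, _root_.smul_apply, key h1, key h2, smul_eq_mul, smul_eq_mul, ← integral_const_mul,
    ← integral_const_mul, ← integral_add
      ((integrable_schwartz_mul u (by fun_prop)).const_mul _)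
      ((integrable_schwartz_mul u (by fun_prop)).const_mul _)]
  congr 1 with x
  ring

/-- `(1 + ‖x‖²)^(-a)` lies in every `L²` Sobolev space as soon as it is square integrable. -/
theorem memSobolev_besselWeight (n : ℕ) {a : ℝ} (ha : (finrank ℝ E : ℝ) < 4 * a) :
    MemSobolev (2 * n : ℝ) 2
      (Lp.toTemperedDistribution ((memLp_two_besselWeight (E := E) ha).toLp _)) := by
  induction n generalizing a with
  | zero =>
    rw [Nat.cast_zero, mul_zero, memSobolev_zero_iff]
    exact ⟨_, rfl⟩
  | succ n ih =>
    have h1 : (finrank ℝ E : ℝ) < 4 * (a + 1) := by linarith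
    have h2 : (finrank ℝ E : ℝ) < 4 * (a + 2) := by linarith
    -- Two orders of regularity are traded for one application of 1 - Δ/4π², which only produces the
    -- exponents a, a + 1 and a + 2, all still square integrable.
    rw [show (2 * ((n + 1 : ℕ) : ℝ)) = 2 + 2 * n by push_cast; ring,
      ← memSobolev_besselPotential_iff, besselPotential_two_eq, laplacian_besselWeight ha h1 h2]
    exact (ih ha).add ((((ih h1).smul _).add ((ih h2).smul _)).smul _)

end BesselWeight

end

/-! ### Traces of Fourier transforms on lines -/

section

open Filter Topology FourierTransform SchwartzMap TemperedDistribution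
open Module (finrank)

noncomputable section LineTrace

theorem sq_lintegral_mul_le {α : Type*} [MeasurableSpace α] {μ : Measure α} {f g : α → ℝ≥0∞}
    (hf : AEMeasurable f μ) (hg : AEMeasurable g μ) :
    (∫⁻ x, f x * g x ∂μ) ^ 2 ≤ (∫⁻ x, f x ^ 2 ∂μ) * ∫⁻ x, g x ^ 2 ∂μ := by
  have h := ENNReal.lintegral_mul_le_Lp_mul_Lq μ Real.HolderConjugate.two_two hf hg
  calc _ ≤ ((∫⁻ x, f x ^ (2 : ℝ) ∂μ) ^ (1 / (2 : ℝ)) *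
        (∫⁻ x, g x ^ (2 : ℝ) ∂μ) ^ (1 / (2 : ℝ))) ^ 2 := by gcongr; exact h
    _ = _ := by
      rw [mul_pow, ← ENNReal.rpow_mul_natCast, ← ENNReal.rpow_mul_natCast]
      simp

theorem one_add_norm_sq_le {E : Type*} [NormedAddCommGroup E] (ξ η : E) :
    1 + ‖ξ‖ ^ 2 ≤ 2 * ((1 + ‖η‖ ^ 2) * (1 + ‖η - ξ‖ ^ 2)) := by
  have h1 : ‖ξ‖ ≤ ‖η‖ + ‖η - ξ‖ := by
    calc ‖ξ‖ = ‖η - (η - ξ)‖ := by rw [sub_sub_cancel]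
      _ ≤ _ := norm_sub_le _ _
  have h2 : ‖ξ‖ ^ 2 ≤ (‖η‖ + ‖η - ξ‖) ^ 2 := by gcongr
  nlinarith [sq_nonneg (‖η‖ - ‖η - ξ‖), mul_nonneg (sq_nonneg ‖η‖) (sq_nonneg ‖η - ξ‖)]

/-- Peetre's inequality. -/
theorem one_add_norm_sq_rpow_le {E : Type*} [NormedAddCommGroup E] {s : ℝ} (hs : 0 ≤ s) (ξ η : E) :
    (1 + ‖ξ‖ ^ 2) ^ (s / 2) ≤ 2 ^ (s / 2) * ((1 + ‖η‖ ^ 2) ^ (s / 2) *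
      ((1 + ‖η - ξ‖ ^ 2) ^ ((s + 1) / 2) * (1 + ‖η - ξ‖ ^ 2) ^ (-(1 / 2) : ℝ))) := by
  -- The exponent s/2 is split as (s + 1)/2 - 1/2: the factor of exponent -1/2 is set aside because
  -- its square is integrable along lines.
  rw [← rpow_add (by positivity), show (s + 1) / 2 + -(1 / 2) = s / 2 by ring,
    ← mul_rpow (by positivity) (by positivity), ← mul_rpow (by positivity) (by positivity)]
  exact rpow_le_rpow (by positivity) (one_add_norm_sq_le ξ η) (by positivity)

/-- Projecting onto `e` gives |η - re| ≥ |⟨η, e⟩ - r|; a translation in `r` then removes η. -/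
theorem lintegral_line_inv_le {E : Type*} [NormedAddCommGroup E] [InnerProductSpace ℝ E] {e : E}
    (he : ‖e‖ = 1) (η : E) :
    ∫⁻ r : ℝ, ENNReal.ofReal ((1 + ‖η - r • e‖ ^ 2) ^ (-(1 / 2) : ℝ)) ^ 2 ≤
      ∫⁻ r : ℝ, ENNReal.ofReal (1 + r ^ 2)⁻¹ := by
  rw [← lintegral_sub_right_eq_self (fun r : ℝ => ENNReal.ofReal (1 + r ^ 2)⁻¹) (inner ℝ η e)]
  refine lintegral_mono fun r => ?_
  rw [← ENNReal.ofReal_pow (by positivity)]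
  refine ENNReal.ofReal_le_ofReal ?_
  rw [← rpow_mul_natCast (by positivity), show (-(1 / 2) : ℝ) * (2 : ℕ) = -1 by norm_num,
    rpow_neg_one]
  gcongr ?_⁻¹
  have h1 : |inner ℝ (η - r • e) e| ≤ ‖η - r • e‖ := by
    simpa [he] using abs_real_inner_le_norm (η - r • e) e
  rw [inner_sub_left, inner_smul_left, real_inner_self_eq_norm_sq, he] at h1
  simp only [conj_trivial, one_pow, mul_one] at h1
  rw [abs_sub_comm] at h1
  rw [← sq_abs (r - _)]
  gcongr

/-- Cauchy–Schwarz against (1 + r²)^((q - s)/2), which is square integrable on the line exactly when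
s - q > 1/2. -/
theorem exists_lintegral_line_mul_le {E : Type*} [NormedAddCommGroup E] [NormedSpace ℝ E] {q s : ℝ}
    (hqs : q + 1 / 2 < s) {F : E → ℂ}
    (hF : Continuous F) {C : ℝ≥0∞} (hC : C ≠ ∞)
    (h : ∀ e : E, ‖e‖ = 1 →
      ∫⁻ r : ℝ, (ENNReal.ofReal ((1 + ‖r • e‖ ^ 2) ^ (s / 2)) * ‖F (r • e)‖ₑ) ^ 2 ≤ C) :
    ∃ C' : ℝ≥0∞, C' ≠ ∞ ∧ ∀ e : E, ‖e‖ = 1 →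
      ∫⁻ r : ℝ, ENNReal.ofReal ((1 + r ^ 2) ^ (q / 2)) * ‖F (r • e)‖ₑ ≤ C' := by
  set D := ∫⁻ r : ℝ, ENNReal.ofReal ((1 + r ^ 2) ^ ((q - s) / 2)) ^ 2 with hD
  have hDfin : D ≠ ∞ := by
    have h1 := integrable_rpow_neg_one_add_norm_sq (E := ℝ) (μ := volume) (r := 2 * (s - q))
      (by simp; linarith)
    refine ne_of_eq_of_ne ?_ h1.lintegral_lt_top.ne
    refine lintegral_congr fun r => ?_
    rw [← ENNReal.ofReal_pow (by positivity), ← rpow_mul_natCast (by positivity)]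
    simp only [Real.norm_eq_abs, sq_abs]
    congr 2
    push_cast
    ring
  refine ⟨1 + C * D, by finiteness, fun e he => ?_⟩
  have hle : ∀ x : ℝ≥0∞, x ≤ 1 + x ^ 2 := fun x => by
    rcases le_total x 1 with hx | hx
    · exact hx.trans le_self_add
    · calc x = x * 1 := (mul_one x).symm
        _ ≤ x * x := by gcongr
        _ ≤ _ := by rw [← pow_two]; exact le_add_self
  refine (hle _).trans (add_le_add_right ?_ 1)
  have hn : Measurable fun r : ℝ => ‖r • e‖ :=
    (by fun_prop : Continuous fun r : ℝ => ‖r • e‖).measurable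
  have hFe : Measurable fun r : ℝ => ‖F (r • e)‖ₑ :=
    (hF.comp (by fun_prop : Continuous fun r : ℝ => r • e)).measurable.enorm
  calc _ = (∫⁻ r : ℝ, (ENNReal.ofReal ((1 + ‖r • e‖ ^ 2) ^ (s / 2)) * ‖F (r • e)‖ₑ) *
        ENNReal.ofReal ((1 + r ^ 2) ^ ((q - s) / 2))) ^ 2 := by
        congr 1
        refine lintegral_congr fun r => ?_
        rw [mul_right_comm, ← ENNReal.ofReal_mul (by positivity), norm_smul, he, mul_one,
          Real.norm_eq_abs, sq_abs, ← rpow_add (by positivity)]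
        congr 3
        ring
    _ ≤ _ := sq_lintegral_mul_le
        (Measurable.aemeasurable (Measurable.mul (by fun_prop) hFe)) (by fun_prop)
    _ ≤ C * D := by gcongr; exact h e he

variable {E : Type*} [NormedAddCommGroup E] [InnerProductSpace ℝ E] [FiniteDimensional ℝ E]
  [MeasurableSpace E] [BorelSpace E]

theorem memLp_weight_mul_fourier {s : ℝ} {u : Lp ℂ 2 (volume : Measure E)}
    (hu : MemSobolev s 2 (Lp.toTemperedDistribution u)) :
    MemLp (fun x => (((1 + ‖x‖ ^ 2) ^ (s / 2) : ℝ) : ℂ) *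
      (𝓕 u : Lp ℂ 2 (volume : Measure E)) x) 2 := by
  obtain ⟨f, hf⟩ := memSobolev_iff_exists_smulLeftCLM_fourier.1 hu
  have hw : (fun x : E => (((1 + ‖x‖ ^ 2) ^ (s / 2) : ℝ) : ℂ)).HasTemperateGrowth := by fun_prop
  refine (memLp_congr_ae ?_).1 (Lp.memLp f)
  refine ae_eq_of_integral_schwartz_eq (locallyIntegrable_Lp_two f)
    ((locallyIntegrable_Lp_two _).continuous_mul hw.1.continuous) fun v => ?_
  have h := congrArg (fun T => T v) hf
  rw [Lp.fourier_toTemperedDistribution_eq] at h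
  simp only [TemperedDistribution.smulLeftCLM_apply_apply, Lp.toTemperedDistribution_apply,
    SchwartzMap.smulLeftCLM_apply_apply hw, smul_eq_mul] at h
  rw [← h]
  congr 1 with x
  ring

theorem memLp_modulation {f : E → ℂ} (hf : MemLp f 2) (ξ : E) :
    MemLp (fun x => (Real.fourierChar (inner ℝ x ξ) : ℂ) * f x) 2 :=
  hf.of_le ((by fun_prop : Continuous fun x : E =>
    (Real.fourierChar (inner ℝ x ξ) : ℂ)).aestronglyMeasurable.mul hf.1)
    (Eventually.of_forall fun x => by rw [norm_mul, Circle.norm_coe, one_mul])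

/-- The `L²` Fourier transform turns modulations into translations. -/
theorem fourier_modulation {f : E → ℂ} (hf : MemLp f 2) (ξ : E) :
    (𝓕 ((memLp_modulation hf ξ).toLp _) : Lp ℂ 2 (volume : Measure E)) =ᵐ[volume]
      fun η => (𝓕 (hf.toLp f) : Lp ℂ 2 (volume : Measure E)) (η - ξ) := by
  have hloc : LocallyIntegrable
      fun η => (𝓕 (hf.toLp f) : Lp ℂ 2 (volume : Measure E)) (η - ξ) :=
    ((Lp.memLp _).comp_measurePreserving (measurePreserving_sub_right volume ξ)).locallyIntegrable
      (by norm_num)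
  refine ae_eq_of_integral_schwartz_eq (locallyIntegrable_Lp_two _) hloc fun u => ?_
  rw [integral_schwartz_mul_fourier_Lp]
  have h1 : ∫ x, (𝓕 u) x * ((memLp_modulation hf ξ).toLp _ : Lp ℂ 2 (volume : Measure E)) x =
      ∫ x, (𝓕 (u.compSubConstCLM ℂ (-ξ))) x * (hf.toLp f : Lp ℂ 2 (volume : Measure E)) x := by
    refine integral_congr_ae ?_
    filter_upwards [(memLp_modulation hf ξ).coeFn_toLp, hf.coeFn_toLp] with x hx hx'
    rw [hx, hx', ← mul_assoc]
    congr 1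
    rw [SchwartzMap.fourier_coe, SchwartzMap.fourier_coe, Real.fourier_eq, Real.fourier_eq,
      ← integral_add_right_eq_self (fun y => Real.fourierChar (-inner ℝ y x) • u y) ξ,
      ← integral_mul_const]
    congr 1 with y
    simp only [compSubConstCLM_apply, sub_neg_eq_add, Circle.smul_def, smul_eq_mul]
    rw [mul_right_comm, ← Circle.coe_mul, ← AddChar.map_add_eq_mul, inner_add_left,
      real_inner_comm ξ x]
    congr 3
    ring
  rw [h1, ← integral_schwartz_mul_fourier_Lp, ← integral_sub_right_eq_self _ ξ]
  congr 1 with y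
  simp

/-- Fourier transform of a product of two `L²` functions as a convolution. -/
theorem fourier_conj_mul {f p : E → ℂ} (hf : MemLp f 2) (hp : MemLp p 2) (ξ : E) :
    𝓕 (fun x => (starRingEnd ℂ) (f x) * p x) ξ =
      ∫ η, (starRingEnd ℂ) ((𝓕 (hf.toLp f) : Lp ℂ 2 (volume : Measure E)) (η - ξ)) *
        (𝓕 (hp.toLp p) : Lp ℂ 2 (volume : Measure E)) η := by
  -- The Fourier integral at ξ is the inner product of `p` with the modulation of `f`; Plancherel
  -- turns that modulation into a translation.
  have h := Lp.inner_fourier_eq ((memLp_modulation hf ξ).toLp _) (hp.toLp p)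
  rw [L2.inner_def, L2.inner_def] at h
  rw [Real.fourier_eq]
  refine Eq.trans ?_ (h.symm.trans ?_)
  · refine integral_congr_ae ?_
    filter_upwards [(memLp_modulation hf ξ).coeFn_toLp, hp.coeFn_toLp] with x hx hx'
    rw [hx, hx', RCLike.inner_apply, Circle.smul_def, smul_eq_mul, map_mul,
      AddChar.map_neg_eq_inv, Circle.coe_inv_eq_conj]
    ring
  · refine integral_congr_ae ?_
    filter_upwards [fourier_modulation hf ξ] with η hη
    rw [hη, RCLike.inner_apply, mul_comm]

/-- Weighted trace on lines through the origin of the Fourier transform of `θ p`, where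
`θ = (1 + ‖x‖²)^(-a)` and `p` has Sobolev regularity. -/
theorem exists_lintegral_line_le {a s : ℝ} (hs : 0 ≤ s) (ha : (finrank ℝ E : ℝ) < 4 * a)
    {p : E → ℂ} (hp : MemLp p 2)
    (hpS : MemSobolev s 2 (Lp.toTemperedDistribution (hp.toLp p))) :
    ∃ C : ℝ≥0∞, C ≠ ∞ ∧ ∀ e : E, ‖e‖ = 1 →
      ∫⁻ r : ℝ, (ENNReal.ofReal ((1 + ‖r • e‖ ^ 2) ^ (s / 2)) *
        ‖𝓕 (fun x => besselWeight E a x * p x) (r • e)‖ₑ) ^ 2 ≤ C := by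
  set hθ := memLp_two_besselWeight (E := E) ha
  obtain ⟨n, hn⟩ := exists_nat_ge (s + 1)
  -- One order more than `s` is needed on θ, to pay for the factor of exponent -1/2 split off in
  -- Peetre's inequality.
  have hθS := (memSobolev_besselWeight (E := E) n ha).mono (s' := s + 1)
    (by nlinarith [(n.cast_nonneg : (0 : ℝ) ≤ n)])
  have hA := memLp_weight_mul_fourier hθS
  have hV := memLp_weight_mul_fourier hpS
  set Θ : E → ℂ := ⇑(𝓕 (hθ.toLp _) : Lp ℂ 2 (volume : Measure E)) with hΘ
  set P : E → ℂ := ⇑(𝓕 (hp.toLp p) : Lp ℂ 2 (volume : Measure E)) with hP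
  set A : E → ℝ≥0∞ := fun η => ‖(((1 + ‖η‖ ^ 2) ^ ((s + 1) / 2) : ℝ) : ℂ) * Θ η‖ₑ with hAdef
  set V : E → ℝ≥0∞ := fun η => ‖(((1 + ‖η‖ ^ 2) ^ (s / 2) : ℝ) : ℂ) * P η‖ₑ with hVdef
  have hAm : AEMeasurable A := hA.1.enorm
  have hVm : AEMeasurable V := hV.1.enorm
  have hfin : ∀ {f : E → ℂ}, MemLp f 2 → ∫⁻ η, ‖f η‖ₑ ^ 2 ≠ ∞ := by
    intro f hf
    have := (eLpNorm_lt_top_iff_lintegral_rpow_enorm_lt_top (by norm_num) (by norm_num)).1 hf.2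
    simpa using this.ne
  set Cπ := ∫⁻ r : ℝ, ENNReal.ofReal (1 + r ^ 2)⁻¹
  have hCπ : Cπ ≠ ∞ := integrable_inv_one_add_sq.lintegral_lt_top.ne
  refine ⟨ENNReal.ofReal (2 ^ (s / 2)) ^ 2 * ((∫⁻ η, A η ^ 2) * ((∫⁻ η, V η ^ 2) * Cπ)), ?_, ?_⟩
  · exact ENNReal.mul_ne_top (by finiteness)
      (ENNReal.mul_ne_top (hfin hA) (ENNReal.mul_ne_top (hfin hV) hCπ))
  intro e he
  set J : E → ℝ≥0∞ := fun η => ENNReal.ofReal ((1 + ‖η‖ ^ 2) ^ (-(1 / 2) : ℝ)) with hJ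
  have hJm : Measurable J := by fun_prop
  have hpt : ∀ ξ : E, ENNReal.ofReal ((1 + ‖ξ‖ ^ 2) ^ (s / 2)) *
        ‖𝓕 (fun x => besselWeight E a x * p x) ξ‖ₑ ≤
      ENNReal.ofReal (2 ^ (s / 2)) * ∫⁻ η, A (η - ξ) * (V η * J (η - ξ)) := by
    intro ξ
    have h1 : (fun x => besselWeight E a x * p x) =
        fun x => (starRingEnd ℂ) (besselWeight E a x) * p x := by
      ext x; rw [besselWeight, Complex.conj_ofReal]
    rw [h1, fourier_conj_mul hθ hp ξ]
    calc _ ≤ ENNReal.ofReal ((1 + ‖ξ‖ ^ 2) ^ (s / 2)) * ∫⁻ η, ‖Θ (η - ξ)‖ₑ * ‖P η‖ₑ := by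
          gcongr
          refine (enorm_integral_le_lintegral_enorm _).trans (lintegral_mono fun η => ?_)
          rw [enorm_mul, RCLike.enorm_conj]
      _ = ∫⁻ η, ENNReal.ofReal ((1 + ‖ξ‖ ^ 2) ^ (s / 2)) * (‖Θ (η - ξ)‖ₑ * ‖P η‖ₑ) :=
          (lintegral_const_mul' _ _ ENNReal.ofReal_ne_top).symm
      _ ≤ ∫⁻ η, ENNReal.ofReal (2 ^ (s / 2)) * (A (η - ξ) * (V η * J (η - ξ))) := by
          refine lintegral_mono fun η => ?_
          simp only [hAdef, hVdef, hJ, ← ofReal_norm, norm_mul, Complex.norm_real]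
          rw [← ENNReal.ofReal_mul (by positivity), ← ENNReal.ofReal_mul (by positivity),
            ← ENNReal.ofReal_mul (by positivity), ← ENNReal.ofReal_mul (by positivity),
            ← ENNReal.ofReal_mul (by positivity)]
          refine ENNReal.ofReal_le_ofReal ?_
          rw [Real.norm_of_nonneg (by positivity), Real.norm_of_nonneg (by positivity)]
          calc _ ≤ _ := mul_le_mul_of_nonneg_right (one_add_norm_sq_rpow_le hs ξ η)
                (by positivity)
            _ = _ := by ring
      _ = _ := lintegral_const_mul' _ _ ENNReal.ofReal_ne_top
  -- Cauchy–Schwarz with `A` alone on one side, so that only `J` still depends on ξ and can be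
  -- integrated along the line after exchanging the integrals.
  have hpt2 : ∀ ξ : E, (ENNReal.ofReal ((1 + ‖ξ‖ ^ 2) ^ (s / 2)) *
        ‖𝓕 (fun x => besselWeight E a x * p x) ξ‖ₑ) ^ 2 ≤
      ENNReal.ofReal (2 ^ (s / 2)) ^ 2 *
        ((∫⁻ η, A η ^ 2) * ∫⁻ η, V η ^ 2 * J (η - ξ) ^ 2) := by
    intro ξ
    refine (pow_le_pow_left' (hpt ξ) 2).trans ?_
    rw [mul_pow]
    gcongr
    refine (sq_lintegral_mul_le (f := fun η => A (η - ξ)) (g := fun η => V η * J (η - ξ))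
      (hAm.comp_quasiMeasurePreserving
      (measurePreserving_sub_right volume ξ).quasiMeasurePreserving)
      (hVm.mul (by fun_prop))).trans ?_
    simp_rw [mul_pow]
    rw [lintegral_sub_right_eq_self (fun η => A η ^ 2) ξ]
  calc _ ≤ ∫⁻ r : ℝ, ENNReal.ofReal (2 ^ (s / 2)) ^ 2 *
        ((∫⁻ η, A η ^ 2) * ∫⁻ η, V η ^ 2 * J (η - r • e) ^ 2) :=
        lintegral_mono fun r => hpt2 _
    _ = ENNReal.ofReal (2 ^ (s / 2)) ^ 2 *
        ((∫⁻ η, A η ^ 2) * ∫⁻ r : ℝ, ∫⁻ η, V η ^ 2 * J (η - r • e) ^ 2) := by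
        rw [lintegral_const_mul' _ _ (by finiteness), lintegral_const_mul' _ _ (hfin hA)]
    _ ≤ _ := by
        gcongr
        rw [lintegral_lintegral_swap]
        · rw [← lintegral_mul_const' _ _ hCπ]
          refine lintegral_mono fun η => ?_
          rw [lintegral_const_mul _ (by fun_prop)]
          gcongr
          exact lintegral_line_inv_le he η
        · exact ((hVm.pow_const 2).comp_snd (μ := volume)).mul (by fun_prop)

end LineTrace

end

/-! ### Line integrals for weighted Sobolev functions -/

section

open Filter Topology FourierTransform SchwartzMap TemperedDistribution
open Module (finrank)

noncomputable section WeightedSobolev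

variable {d : ℕ}

/-- `f` is square integrable with Sobolev regularity `s`. -/
def HasSobolevReg (s : ℝ) (f : EuclideanSpace ℝ (Fin d) → ℂ) : Prop :=
  ∃ h : MemLp f 2, MemSobolev s 2 (Lp.toTemperedDistribution (h.toLp f))

theorem HasSobolevReg.add {s : ℝ} {f g : EuclideanSpace ℝ (Fin d) → ℂ} (hf : HasSobolevReg s f)
    (hg : HasSobolevReg s g) : HasSobolevReg s (f + g) := by
  obtain ⟨hf, hf'⟩ := hf
  obtain ⟨hg, hg'⟩ := hg
  refine ⟨hf.add hg, ?_⟩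
  have h := hf'.add hg'
  rwa [← Lp.toTemperedDistributionCLM_apply, ← Lp.toTemperedDistributionCLM_apply, ← map_add,
    ← MemLp.toLp_add] at h

theorem HasSobolevReg.zero (s : ℝ) :
    HasSobolevReg s (0 : EuclideanSpace ℝ (Fin d) → ℂ) := by
  refine ⟨MemLp.zero, ?_⟩
  rw [MemLp.toLp_zero, ← Lp.toTemperedDistributionCLM_apply, map_zero]
  exact memSobolev_fun_zero _ _ s 2

theorem HasSobolevReg.sum {ι : Type*} (S : Finset ι) {s : ℝ}
    {f : ι → EuclideanSpace ℝ (Fin d) → ℂ} (hf : ∀ i ∈ S, HasSobolevReg s (f i)) :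
    HasSobolevReg s (∑ i ∈ S, f i) :=
  Finset.sum_induction f (HasSobolevReg s) (fun _ _ => HasSobolevReg.add) (HasSobolevReg.zero s) hf

theorem monomialWeight_add_single (α : Fin d → ℕ) (l : Fin d) (v : EuclideanSpace ℝ (Fin d)) :
    monomialWeight (α + Pi.single l 2) v = v l ^ 2 * monomialWeight α v := by
  simp only [monomialWeight, Pi.add_apply, pow_add, Finset.prod_mul_distrib]
  rw [mul_comm]
  congr 1
  rw [Finset.prod_eq_single l]
  · simp
  · intro i _ hi; simp [hi]
  · simp

/-- Weights `(1 + |v|²)^i v^α` of total degree at most `M` are allowed in the weighted Sobolev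
space. -/
theorem MemWeightedSobolev.hasSobolevReg {s : ℝ} {M : ℕ} {g : EuclideanSpace ℝ (Fin d) → ℝ}
    (hg : MemWeightedSobolev s M g) (i : ℕ) (α : Fin d → ℕ) (hα : ∑ l, α l + 2 * i ≤ M) :
    HasSobolevReg s fun v => (((1 + ‖v‖ ^ 2) ^ i * (monomialWeight α v * g v) : ℝ) : ℂ) := by
  induction i generalizing α with
  | zero => simpa [HasSobolevReg] using hg α (by simpa using hα)
  | succ i ih =>
    have h1 := ih α (by omega)
    -- One factor 1 + |v|² is expanded as 1 + ∑ v_l², which raises the degree of the monomial by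
    -- two.
    have h2 : ∀ l ∈ Finset.univ, HasSobolevReg s fun v =>
        (((1 + ‖v‖ ^ 2) ^ i * (monomialWeight (α + Pi.single l 2) v * g v) : ℝ) : ℂ) := by
      intro l _
      refine ih _ ?_
      simp only [Pi.add_apply, Finset.sum_add_distrib, Finset.sum_pi_single', Finset.mem_univ,
        if_true]
      omega
    convert h1.add (HasSobolevReg.sum Finset.univ h2) using 1
    ext v
    simp only [Pi.add_apply, Finset.sum_apply, monomialWeight_add_single]
    rw [← Complex.ofReal_sum, ← Complex.ofReal_add]
    congr 1
    have h3 : ∑ l, (1 + ‖v‖ ^ 2) ^ i * (v l ^ 2 * monomialWeight α v * g v) =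
        (1 + ‖v‖ ^ 2) ^ i * (‖v‖ ^ 2 * (monomialWeight α v * g v)) := by
      rw [EuclideanSpace.real_norm_sq_eq, ← Finset.mul_sum, Finset.sum_mul]
      simp only [mul_assoc]
    rw [h3]
    ring

/-- A function in the weighted Sobolev space is integrable, and its Fourier transform has uniformly
bounded weighted integrals along lines through the origin. -/
theorem MemWeightedSobolev.exists_line_bound {q s : ℝ} (hs : 0 ≤ s) (hqs : q + 1 / 2 < s)
    {g : EuclideanSpace ℝ (Fin d) → ℝ} (hg : MemWeightedSobolev s (2 + ⌈(d : ℝ) / 2⌉₊) g) :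
    Integrable (fun v => (g v : ℂ)) ∧
    ∃ C : ℝ≥0∞, C ≠ ∞ ∧ ∀ e : EuclideanSpace ℝ (Fin d), ‖e‖ = 1 →
      ∫⁻ r : ℝ, ENNReal.ofReal ((1 + r ^ 2) ^ (q / 2)) *
        ‖𝓕 (fun v => (g v : ℂ)) (r • e)‖ₑ ≤ C := by
  -- The largest power of 1 + |v|² the weight allows. Rounding down still leaves 2j ≥ ⌈d/2⌉ + 1 >
  -- d/2, which makes (1 + |v|²)^(-j) square integrable.
  set j := (2 + ⌈(d : ℝ) / 2⌉₊) / 2 with hj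
  have hd : (finrank ℝ (EuclideanSpace ℝ (Fin d)) : ℝ) < 4 * (j : ℝ) := by
    have h1 : (d : ℝ) / 2 ≤ (⌈(d : ℝ) / 2⌉₊ : ℝ) := Nat.le_ceil _
    have h2 : ⌈(d : ℝ) / 2⌉₊ + 1 ≤ 2 * j := by omega
    have h3 : (⌈(d : ℝ) / 2⌉₊ : ℝ) + 1 ≤ 2 * j := by exact_mod_cast h2
    rw [finrank_euclideanSpace_fin]
    linarith
  obtain ⟨hp, hpS⟩ := hg.hasSobolevReg j 0 (by simp; omega)
  set p : EuclideanSpace ℝ (Fin d) → ℂ :=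
    fun v => (((1 + ‖v‖ ^ 2) ^ j * (monomialWeight 0 v * g v) : ℝ) : ℂ)
  have hprod : (fun v => (g v : ℂ)) =
      fun v => besselWeight (EuclideanSpace ℝ (Fin d)) j v * p v := by
    ext v
    have h1 : (0 : ℝ) < 1 + ‖v‖ ^ 2 := by positivity
    simp only [besselWeight, p]
    rw [← Complex.ofReal_mul, rpow_neg h1.le, rpow_natCast, ← mul_assoc,
      inv_mul_cancel₀ (by positivity)]
    simp [monomialWeight]
  have hint : Integrable (fun v => (g v : ℂ)) := by
    rw [hprod]
    exact (memLp_two_besselWeight hd).integrable_mul hp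
  refine ⟨hint, ?_⟩
  obtain ⟨C, hC, hline⟩ := exists_lintegral_line_le hs hd hp hpS
  rw [← hprod] at hline
  exact exists_lintegral_line_mul_le hqs (continuous_fourier_of_integrable hint) hC hline

end WeightedSobolev

/-! ### Uniform moments of the Hartree kernel -/

noncomputable section Hartree

variable {d : ℕ}

theorem fourierHat_eq (f : EuclideanSpace ℝ (Fin d) → ℝ) (p : EuclideanSpace ℝ (Fin d)) :
    fourierHat f p = 𝓕 (fun v => (f v : ℂ)) ((2 * π)⁻¹ • p) := by
  rw [Real.fourier_eq', fourierHat]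
  congr 1 with v
  rw [smul_eq_mul, inner_smul_right, real_inner_comm p v]
  congr 2
  rw [← mul_assoc]
  have : -2 * π * (2 * π)⁻¹ = -1 := by field_simp
  rw [this]
  push_cast
  ring

theorem norm_fourierHat_le (f : EuclideanSpace ℝ (Fin d) → ℝ) (p : EuclideanSpace ℝ (Fin d)) :
    ‖fourierHat f p‖ ≤ ∫ v, ‖f v‖ := by
  refine (norm_integral_le_integral_norm _).trans (le_of_eq ?_)
  congr 1 with v
  rw [norm_mul, Complex.norm_real, Complex.norm_exp]
  simp

theorem continuous_hartreeKernel {hbar : ℝ} {w g : EuclideanSpace ℝ (Fin d) → ℝ}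
    (hg : Integrable fun v => (g v : ℂ)) (k : EuclideanSpace ℝ (Fin d)) :
    Continuous fun t => hartreeKernel hbar w g t k := by
  have h := continuous_fourier_of_integrable hg
  simp only [hartreeKernel, fourierHat_eq g]
  fun_prop

/-- This bound degenerates as ħ → 0; it serves only qualitative purposes and does not enter the
final constant. -/
theorem norm_hartreeKernel_le_const {hbar : ℝ} (w g : EuclideanSpace ℝ (Fin d) → ℝ)
    (k : EuclideanSpace ℝ (Fin d)) (t : ℝ) :
    ‖hartreeKernel hbar w g t k‖ ≤
      |1 / (2 * π) ^ d * (2 / hbar)| * ‖fourierHat w k‖ * 1 * ∫ v, ‖g v‖ := by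
  rw [hartreeKernel, norm_mul, norm_mul, norm_mul, Complex.norm_real, Complex.norm_real,
    Real.norm_eq_abs, Real.norm_eq_abs]
  gcongr
  · exact abs_sin_le_one _
  · exact norm_fourierHat_le _ _

/-- The bound |sin x| ≤ |x| cancels the prefactor 2/ħ, at the price of one factor t|k|². -/
theorem norm_hartreeKernel_le {hbar : ℝ} (hh : 0 < hbar) (w g : EuclideanSpace ℝ (Fin d) → ℝ)
    (k : EuclideanSpace ℝ (Fin d)) {t : ℝ} (ht : 0 ≤ t) :
    ‖hartreeKernel hbar w g t k‖ ≤
      (1 / (2 * π) ^ d * ∫ v, ‖w v‖) * (t * ‖k‖ ^ 2) * ‖fourierHat g (t • k)‖ := by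
  rw [hartreeKernel, norm_mul, norm_mul, norm_mul, Complex.norm_real, Complex.norm_real,
    Real.norm_of_nonneg (by positivity), Real.norm_eq_abs]
  have h1 : |sin (hbar / 2 * t * ‖k‖ ^ 2)| ≤ hbar / 2 * t * ‖k‖ ^ 2 :=
    (abs_sin_le_abs (x := hbar / 2 * t * ‖k‖ ^ 2)).trans_eq (abs_of_nonneg (by positivity))
  calc _ ≤ 1 / (2 * π) ^ d * (2 / hbar) * (∫ v, ‖w v‖) * (hbar / 2 * t * ‖k‖ ^ 2) *
        ‖fourierHat g (t • k)‖ := by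
        gcongr
        exact norm_fourierHat_le w k
    _ = _ := by field_simp

theorem hartreeLaplace_eq (hbar : ℝ) (w g : EuclideanSpace ℝ (Fin d) → ℝ) (lam : ℂ)
    (k : EuclideanSpace ℝ (Fin d)) :
    hartreeLaplace hbar w g lam k =
      ∫ t in Ioi (0 : ℝ), Complex.exp (-(lam * t)) * hartreeKernel hbar w g t k := by
  rw [hartreeLaplace, ← integral_const_mul]
  congr 1 with t
  rw [hartreeKernel, show 1 / 2 * hbar * t * ‖k‖ ^ 2 = hbar / 2 * t * ‖k‖ ^ 2 by ring]
  ring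

theorem lintegral_comp_mul_left_eq (f : ℝ → ℝ≥0∞) (hf : Measurable f) {c : ℝ} (hc : 0 < c) :
    ∫⁻ t : ℝ, f (c * t) = ENNReal.ofReal c⁻¹ * ∫⁻ r, f r := by
  rw [← lintegral_map hf (measurable_const_mul c), Real.map_volume_mul_left hc.ne',
    lintegral_smul_measure, abs_of_pos (by positivity), smul_eq_mul]

/-- Polynomial moments of the Hartree kernel are bounded uniformly in `hbar` and `k`. -/
theorem exists_moment_bound {σ : ℕ} (w : EuclideanSpace ℝ (Fin d) → ℝ)
    {g : EuclideanSpace ℝ (Fin d) → ℝ} (hg : Integrable fun v => (g v : ℂ)) {C : ℝ≥0∞} (hC : C ≠ ∞)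
    (hline : ∀ e : EuclideanSpace ℝ (Fin d), ‖e‖ = 1 →
      ∫⁻ r : ℝ, ENNReal.ofReal ((1 + r ^ 2) ^ (((σ : ℝ) + 1) / 2)) *
        ‖𝓕 (fun v => (g v : ℂ)) (r • e)‖ₑ ≤ C) :
    ∃ L : ℝ≥0, ∀ hbar : ℝ, 0 < hbar → ∀ k : EuclideanSpace ℝ (Fin d), k ≠ 0 → ∀ j ≤ σ,
      IntegrableOn (fun t => (‖k‖ * t) ^ j * ‖hartreeKernel hbar w g t k‖) (Ioi 0) ∧
      ∫ t in Ioi 0, (‖k‖ * t) ^ j * ‖hartreeKernel hbar w g t k‖ ≤ L := by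
  set W := 1 / (2 * π) ^ d * ∫ v, ‖w v‖ with hW
  have hW0 : 0 ≤ W := by positivity
  -- Writing |k|t = 2π·ct gives at most σ + 1 factors 2π, and the substitution r = ct gives one
  -- more. The remaining |k| cancels against c⁻¹.
  set L : ℝ≥0∞ := ENNReal.ofReal (W * (2 * π) ^ (σ + 2)) * C with hL
  have hLfin : L ≠ ∞ := by finiteness
  refine ⟨L.toNNReal, fun hbar hh k hk j hj => ?_⟩
  have hk0 : 0 < ‖k‖ := norm_pos_iff.2 hk
  set e := ‖k‖⁻¹ • k with he
  have he1 : ‖e‖ = 1 := by rw [he, norm_smul, norm_inv, norm_norm, inv_mul_cancel₀ hk0.ne']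
  set c := (2 * π)⁻¹ * ‖k‖ with hc
  have hc0 : 0 < c := by positivity
  set F : ℝ → ℝ≥0∞ := fun r => ENNReal.ofReal ((1 + r ^ 2) ^ (((σ : ℝ) + 1) / 2)) *
        ‖𝓕 (fun v => (g v : ℂ)) (r • e)‖ₑ with hF
  have hFm : Measurable F := by
    have := (continuous_fourier_of_integrable hg).comp
      (by fun_prop : Continuous fun r : ℝ => r • e)
    exact Measurable.mul (by fun_prop) this.measurable.enorm
  have hcont : Continuous fun t => (‖k‖ * t) ^ j * ‖hartreeKernel hbar w g t k‖ :=
    (by fun_prop : Continuous fun t : ℝ => (‖k‖ * t) ^ j).mul (continuous_hartreeKernel hg k).norm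
  have hpt : ∀ t ∈ Ioi (0 : ℝ), ‖(‖k‖ * t) ^ j * ‖hartreeKernel hbar w g t k‖‖ₑ ≤
      ENNReal.ofReal (W * ‖k‖ * (2 * π) ^ (σ + 1)) * F (c * t) := by
    intro t ht
    have ht0 : 0 < t := ht
    simp only [hF]
    rw [← ofReal_norm, ← ofReal_norm, ← ENNReal.ofReal_mul (by positivity),
      ← ENNReal.ofReal_mul (by positivity)]
    refine ENNReal.ofReal_le_ofReal ?_
    rw [Real.norm_of_nonneg (by positivity)]
    have hgk : fourierHat g (t • k) = 𝓕 (fun v => (g v : ℂ)) ((c * t) • e) := by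
      rw [fourierHat_eq, he, hc, smul_smul, smul_smul]
      field_simp
    have hpow : (c * t) ^ (j + 1) ≤ (1 + (c * t) ^ 2) ^ (((σ : ℝ) + 1) / 2) := by
      have h1 : (1 : ℝ) ≤ 1 + (c * t) ^ 2 := le_add_of_nonneg_right (by positivity)
      calc (c * t) ^ (j + 1) = ((c * t) ^ 2) ^ (((j : ℝ) + 1) / 2) := by
            rw [← rpow_natCast (c * t) 2, ← rpow_mul (by positivity), ← rpow_natCast]
            congr 1
            push_cast
            ring
        _ ≤ (1 + (c * t) ^ 2) ^ (((j : ℝ) + 1) / 2) :=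
            rpow_le_rpow (by positivity) (by linarith) (by positivity)
        _ ≤ _ := rpow_le_rpow_of_exponent_le h1 (by
            have : (j : ℝ) ≤ σ := by exact_mod_cast hj
            linarith)
    have h2pi : (1 : ℝ) ≤ 2 * π := by linarith [Real.pi_gt_three]
    calc _ ≤ (‖k‖ * t) ^ j * (W * (t * ‖k‖ ^ 2) * ‖fourierHat g (t • k)‖) := by
          gcongr
          exact norm_hartreeKernel_le hh w g k ht0.le
      _ = W * ‖k‖ * (2 * π) ^ (j + 1) * ((c * t) ^ (j + 1) * ‖fourierHat g (t • k)‖) := by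
          have : ‖k‖ * t = 2 * π * (c * t) := by rw [hc]; field_simp
          rw [show (‖k‖ * t) ^ j * (W * (t * ‖k‖ ^ 2) * ‖fourierHat g (t • k)‖) =
            W * ‖k‖ * ((‖k‖ * t) ^ (j + 1) * ‖fourierHat g (t • k)‖) by ring, this, mul_pow]
          ring
      _ ≤ W * ‖k‖ * (2 * π) ^ (σ + 1) * ((1 + (c * t) ^ 2) ^ (((σ : ℝ) + 1) / 2) *
            ‖𝓕 (fun v => (g v : ℂ)) ((c * t) • e)‖) := by
          rw [hgk]
          gcongr
  have hlint : ∫⁻ t in Ioi 0, ‖(‖k‖ * t) ^ j * ‖hartreeKernel hbar w g t k‖‖ₑ ≤ L := by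
    calc _ ≤ ∫⁻ t in Ioi 0, ENNReal.ofReal (W * ‖k‖ * (2 * π) ^ (σ + 1)) * F (c * t) :=
          setLIntegral_mono' measurableSet_Ioi hpt
      _ ≤ ∫⁻ t, ENNReal.ofReal (W * ‖k‖ * (2 * π) ^ (σ + 1)) * F (c * t) :=
          setLIntegral_le_lintegral _ _
      _ = ENNReal.ofReal (W * ‖k‖ * (2 * π) ^ (σ + 1)) * (ENNReal.ofReal c⁻¹ * ∫⁻ r, F r) := by
          rw [lintegral_const_mul' _ _ ENNReal.ofReal_ne_top, lintegral_comp_mul_left_eq F hFm hc0]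
      _ ≤ ENNReal.ofReal (W * ‖k‖ * (2 * π) ^ (σ + 1)) * (ENNReal.ofReal c⁻¹ * C) := by
          gcongr
          exact hline e he1
      _ = L := by
          rw [← mul_assoc, ← ENNReal.ofReal_mul (by positivity), hL, hc]
          congr 2
          rw [mul_inv, inv_inv]
          field_simp
          ring
  have hint : IntegrableOn (fun t => (‖k‖ * t) ^ j * ‖hartreeKernel hbar w g t k‖) (Ioi 0) :=
    ⟨hcont.aestronglyMeasurable, hlint.trans_lt hLfin.lt_top⟩
  refine ⟨hint, ?_⟩
  refine (Real.le_norm_self _).trans ((norm_integral_le_lintegral_norm _).trans ?_)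
  simp_rw [ofReal_norm]
  exact ENNReal.toReal_mono hLfin hlint

end Hartree

end

/-! ### The bracket weight and the damping estimate -/

section

open Filter Topology

noncomputable section LinearDamping

variable {d : ℕ}

theorem one_le_japaneseBracket (x y : EuclideanSpace ℝ (Fin d)) : 1 ≤ japaneseBracket x y := by
  rw [japaneseBracket, Real.one_le_sqrt]
  linarith [sq_nonneg ‖x‖, sq_nonneg ‖y‖]

theorem norm_le_japaneseBracket (x y : EuclideanSpace ℝ (Fin d)) : ‖y‖ ≤ japaneseBracket x y :=
  Real.le_sqrt_of_sq_le (by linarith [sq_nonneg ‖x‖])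

theorem sqrt_le_japaneseBracket (x y : EuclideanSpace ℝ (Fin d)) :
    Real.sqrt (1 + ‖x‖ ^ 2) ≤ japaneseBracket x y :=
  Real.sqrt_le_sqrt (by linarith [sq_nonneg ‖y‖])

theorem japaneseBracket_le (x y : EuclideanSpace ℝ (Fin d)) :
    japaneseBracket x y ≤ Real.sqrt (1 + ‖x‖ ^ 2) + ‖y‖ := by
  rw [japaneseBracket, Real.sqrt_le_left (by positivity), add_sq, Real.sq_sqrt (by positivity)]
  have : 0 ≤ 2 * Real.sqrt (1 + ‖x‖ ^ 2) * ‖y‖ := by positivity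
  linarith

theorem continuous_japaneseBracket_line (k : EuclideanSpace ℝ (Fin d)) :
    Continuous fun t : ℝ => japaneseBracket k (t • k) := by
  unfold japaneseBracket; fun_prop

theorem eLpNorm_weightedMode (m : ℝ) (σ : ℕ) (f : ℝ → EuclideanSpace ℝ (Fin d) → ℂ)
    (k : EuclideanSpace ℝ (Fin d)) (μ : Measure ℝ) :
    eLpNorm (weightedMode m σ f k) 2 μ = ‖((‖k‖ ^ m : ℝ) : ℂ)‖ₑ *
      eLpNorm (fun t => ((japaneseBracket k (t • k) ^ σ : ℝ) : ℂ) * f t k) 2 μ := by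
  rw [← eLpNorm_const_smul]
  congr 1
  ext t
  simp [weightedMode, mul_assoc]

theorem memLp_of_memLp_weightedMode {m : ℝ} {σ : ℕ} {H : ℝ → EuclideanSpace ℝ (Fin d) → ℂ}
    {k : EuclideanSpace ℝ (Fin d)} (hk : k ≠ 0) {μ : Measure ℝ}
    (hH : MemLp (weightedMode m σ H k) 2 μ) : MemLp (fun t => H t k) 2 μ := by
  have hk0 : 0 < ‖k‖ := norm_pos_iff.2 hk
  have hb : ∀ t : ℝ, 0 < japaneseBracket k (t • k) := fun t =>
    one_pos.trans_le (one_le_japaneseBracket _ _)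
  have hpos : ∀ t : ℝ, 0 < ‖k‖ ^ m * japaneseBracket k (t • k) ^ σ := fun t =>
    mul_pos (rpow_pos_of_pos hk0 m) (pow_pos (hb t) σ)
  have heq : (fun t => H t k) = fun t =>
      (((‖k‖ ^ m * japaneseBracket k (t • k) ^ σ)⁻¹ : ℝ) : ℂ) * weightedMode m σ H k t := by
    ext t
    rw [weightedMode, ← mul_assoc, ← Complex.ofReal_mul, inv_mul_cancel₀ (hpos t).ne']
    simp
  have hcont : Continuous fun t : ℝ =>
      (((‖k‖ ^ m * japaneseBracket k (t • k) ^ σ)⁻¹ : ℝ) : ℂ) :=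
    Complex.continuous_ofReal.comp (((continuous_const.mul
      ((continuous_japaneseBracket_line k).pow σ))).inv₀ fun t => (hpos t).ne')
  rw [heq]
  refine hH.of_le_mul (c := (‖k‖ ^ m)⁻¹) (hcont.aestronglyMeasurable.mul hH.1)
    (Eventually.of_forall fun t => ?_)
  have h1 := hpos t
  have h2 := rpow_pos_of_pos hk0 m
  rw [norm_mul, Complex.norm_real, Real.norm_of_nonneg (by positivity)]
  gcongr
  exact le_mul_of_one_le_right h2.le (one_le_pow₀ (one_le_japaneseBracket _ _))

/-- The integrands can differ only at the endpoint s = t. -/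
theorem volterra_kernel_indicator {K φ : ℝ → ℂ} {t : ℝ} (ht : 0 ≤ t) :
    ∫ s in (0 : ℝ)..t, indicator (Ioi 0) K (t - s) * φ s = ∫ s in (0 : ℝ)..t, K (t - s) * φ s := by
  rw [intervalIntegral.integral_of_le ht, intervalIntegral.integral_of_le ht,
    integral_Ioc_eq_integral_Ioo, integral_Ioc_eq_integral_Ioo]
  refine setIntegral_congr_fun measurableSet_Ioo fun s hs => ?_
  have h1 : t - s ∈ Ioi (0 : ℝ) := sub_pos.2 hs.2
  simp only [indicator_of_mem h1]

end LinearDamping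

end

theorem mainTheorem5 (d : ℕ) (σ : ℕ) (δ₀ : ℝ) (hδ₀ : 0 < δ₀)
    (w g : EuclideanSpace ℝ (Fin d) → ℝ) (κ : ℝ)
    (hw : Integrable w volume)
    (hg : MemWeightedSobolev ((σ : ℝ) + 3 / 2 + δ₀) (2 + ⌈(d : ℝ) / 2⌉₊) g)
    (hPenrose : UniformPenrose w g κ) :
    ∃ C : ℝ≥0, ∀ hbar ∈ Ioc (0 : ℝ) 1, ∀ T : ℝ, 0 < T → ∀ m : ℝ,
      ∀ H φ : ℝ → EuclideanSpace ℝ (Fin d) → ℂ, ∀ k : EuclideanSpace ℝ (Fin d),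
        IsVolterraSolution hbar w g T H φ k →
        MemLp (weightedMode m σ H k) 2 (volume.restrict (Icc 0 T)) →
        eLpNorm (weightedMode m σ φ k) 2 (volume.restrict (Icc 0 T)) ≤
          C * eLpNorm (weightedMode m σ H k) 2 (volume.restrict (Icc 0 T)) := by
  obtain ⟨hκ, hP⟩ := hPenrose
  -- The weight order σ + 1 is σ from the bracket and one from the sine bound; passing to L¹ on
  -- lines takes a further 1/2 + δ₀.
  obtain ⟨hgi, C₀, hC₀, hline⟩ := hg.exists_line_bound (q := (σ : ℝ) + 1) (by positivity)
    (by linarith)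
  obtain ⟨L, hL⟩ := exists_moment_bound w hgi hC₀ hline
  obtain ⟨D, hD⟩ := exists_weighted_volterra_bound hκ L σ
  -- The 1 serves k = 0. The factor 2^(σ-1) comes from (x + y)^σ ≤ 2^(σ-1)(x^σ + y^σ), which also
  -- holds for σ = 0 with truncated subtraction.
  refine ⟨1 + 2 ^ (σ - 1) * ((κ⁻¹).toNNReal + D), fun hbar hh T hT m H φ k hsol hH => ?_⟩
  set μ := volume.restrict (Icc (0 : ℝ) T) with hμ
  rcases eq_or_ne k 0 with rfl | hk
  -- At k = 0 the sine vanishes, so φ = H almost everywhere.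
  · have hae : weightedMode m σ φ 0 =ᵐ[μ] weightedMode m σ H 0 := by
      filter_upwards [hsol.equation] with t ht
      simp only [weightedMode]
      rw [ht]
      simp [hartreeKernel]
    rw [eLpNorm_congr_ae hae]
    exact le_mul_of_one_le_left' (by exact_mod_cast le_self_add)
  set K : ℝ → ℂ := indicator (Ioi 0) fun t => hartreeKernel hbar w g t k with hK
  have hKt : ∀ {t : ℝ}, t ∈ Ioi (0 : ℝ) → K t = hartreeKernel hbar w g t k := fun ht =>
    indicator_of_mem ht _
  have hKm : ∀ j ≤ σ, IntegrableOn (fun t => (‖k‖ * t) ^ j * ‖K t‖) (Ioi 0) ∧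
      ∫ t in Ioi 0, (‖k‖ * t) ^ j * ‖K t‖ ≤ L := by
    intro j hj
    have hcongr : EqOn (fun t => (‖k‖ * t) ^ j * ‖K t‖)
        (fun t => (‖k‖ * t) ^ j * ‖hartreeKernel hbar w g t k‖) (Ioi 0) := fun t ht => by
      simp only [hKt ht]
    rw [integrableOn_congr_fun hcongr measurableSet_Ioi,
      setIntegral_congr_fun measurableSet_Ioi hcongr]
    exact hL hbar hh.1 k hk j hj
  have hKint : Integrable K := by
    rw [hK, integrable_indicator_iff measurableSet_Ioi]
    have h1 := (hL hbar hh.1 k hk 0 (Nat.zero_le _)).1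
    simp only [pow_zero, one_mul] at h1
    exact (integrable_norm_iff (continuous_hartreeKernel hgi k).aestronglyMeasurable).1 h1
  set B := |1 / (2 * π) ^ d * (2 / hbar)| * ‖fourierHat w k‖ * 1 * ∫ v, ‖g v‖
  have hB : ∀ t, ‖K t‖ ≤ B := fun t =>
    (norm_indicator_le_norm_self _ _).trans (norm_hartreeKernel_le_const w g k t)
  have h0 : ∀ t ≤ 0, K t = 0 := fun t ht => indicator_of_notMem (not_lt.2 ht) _
  have hlap : ∀ lam : ℂ, 0 ≤ lam.re →
      κ ≤ ‖1 + ∫ t in Ioi (0 : ℝ), Complex.exp (-(lam * t)) * K t‖ := by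
    intro lam hlam
    have h1 := hP hbar hh lam hlam k
    rw [hartreeLaplace_eq] at h1
    have hc : EqOn (fun t : ℝ => Complex.exp (-(lam * t)) * K t)
        (fun t : ℝ => Complex.exp (-(lam * t)) * hartreeKernel hbar w g t k) (Ioi 0) :=
      fun t ht => by simp only [hKt ht]
    rwa [setIntegral_congr_fun measurableSet_Ioi hc]
  have heq : ∀ᵐ t ∂μ, φ t k = H t k - ∫ s in (0 : ℝ)..t, K (t - s) * φ s k := by
    filter_upwards [hsol.equation, ae_restrict_mem measurableSet_Icc] with t h1 ht
    rw [hK, volterra_kernel_indicator (φ := fun s => φ s k) ht.1, ← h1]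
  have hH2 := memLp_of_memLp_weightedMode hk hH
  have hφ2 := memLp_two_of_volterra hB hsol.integrableOn hH2 heq
  have hbase := eLpNorm_volterra_le hKint hB h0 hκ hlap hφ2 hH2 heq
  set N := eLpNorm (fun t => ((japaneseBracket k (t • k) ^ σ : ℝ) : ℂ) * H t k) 2 μ with hN
  have hweight := hD K (fun t => φ t k) (fun t => H t k) ‖k‖ B T N (norm_nonneg k) hKint hB h0
    hlap (fun j hj => (hKm j hj).1) (fun j hj => (hKm j hj).2) hφ2 hH2 heq (fun j hj => by
      refine eLpNorm_mono_ae ?_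
      filter_upwards [ae_restrict_mem measurableSet_Icc] with t ht
      have ht0 := ht.1
      have hb := one_le_japaneseBracket k (t • k)
      rw [norm_mul, norm_mul, Complex.norm_real, Complex.norm_real,
        Real.norm_of_nonneg (by positivity), Real.norm_of_nonneg (by positivity)]
      gcongr
      have h1 := norm_le_japaneseBracket k (t • k)
      rw [norm_smul, Real.norm_of_nonneg ht0, mul_comm] at h1
      calc (‖k‖ * t) ^ j ≤ japaneseBracket k (t • k) ^ j := by gcongr
        _ ≤ _ := pow_le_pow_right₀ hb hj)
  set b := Real.sqrt (1 + ‖k‖ ^ 2) with hb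
  -- Since `b` does not depend on time, it passes through the unweighted estimate and is then
  -- dominated by the bracket on the source.
  have hconst : eLpNorm (fun t => ((b ^ σ : ℝ) : ℂ) * φ t k) 2 μ ≤ (κ⁻¹).toNNReal * N := by
    have h1 : (fun t => ((b ^ σ : ℝ) : ℂ) * φ t k) = ((b ^ σ : ℝ) : ℂ) • fun t => φ t k := rfl
    rw [h1, eLpNorm_const_smul]
    calc _ ≤ ‖((b ^ σ : ℝ) : ℂ)‖ₑ * (ENNReal.ofReal κ⁻¹ * eLpNorm (fun t => H t k) 2 μ) := by
          gcongr
      _ = (κ⁻¹).toNNReal * eLpNorm (((b ^ σ : ℝ) : ℂ) • fun t => H t k) 2 μ := by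
          rw [eLpNorm_const_smul, mul_left_comm]; rfl
      _ ≤ _ := by
          gcongr
          refine eLpNorm_mono fun t => ?_
          have hj : 0 ≤ japaneseBracket k (t • k) ^ σ := pow_nonneg (Real.sqrt_nonneg _) _
          rw [Pi.smul_apply, smul_eq_mul, norm_mul, norm_mul, Complex.norm_real,
            Complex.norm_real, Real.norm_of_nonneg (by positivity),
            Real.norm_of_nonneg hj]
          gcongr
          exact sqrt_le_japaneseBracket k (t • k)
  rw [eLpNorm_weightedMode, eLpNorm_weightedMode, mul_left_comm]
  gcongr
  rw [← hN]
  have hsum : eLpNorm (fun t => ((japaneseBracket k (t • k) ^ σ : ℝ) : ℂ) * φ t k) 2 μ ≤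
      eLpNorm (((2 ^ (σ - 1) : ℝ) : ℂ) • fun t => ((‖((b ^ σ : ℝ) : ℂ) * φ t k‖ +
        ‖(((‖k‖ * t) ^ σ : ℝ) : ℂ) * φ t k‖ : ℝ) : ℂ)) 2 μ := by
    refine eLpNorm_mono_ae ?_
    filter_upwards [ae_restrict_mem measurableSet_Icc] with t ht
    have ht0 := ht.1
    have hj : 0 ≤ japaneseBracket k (t • k) ^ σ := pow_nonneg (Real.sqrt_nonneg _) _
    rw [Pi.smul_apply, smul_eq_mul, norm_mul, norm_mul, norm_mul, norm_mul, Complex.norm_real,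
      Complex.norm_real, Complex.norm_real, Complex.norm_real, Complex.norm_real,
      Real.norm_of_nonneg hj,
      Real.norm_of_nonneg (by positivity : (0 : ℝ) ≤ 2 ^ (σ - 1)),
      Real.norm_of_nonneg (by positivity : (0 : ℝ) ≤ b ^ σ),
      Real.norm_of_nonneg (by positivity : (0 : ℝ) ≤ (‖k‖ * t) ^ σ),
      Real.norm_of_nonneg (by positivity), ← add_mul, ← mul_assoc]
    gcongr
    have h1 := japaneseBracket_le k (t • k)
    rw [norm_smul, Real.norm_of_nonneg ht0, mul_comm t] at h1
    calc _ ≤ (b + ‖k‖ * t) ^ σ := by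
          have := one_le_japaneseBracket k (t • k)
          gcongr
      _ ≤ _ := add_pow_le (Real.sqrt_nonneg _) (by positivity) σ
  refine hsum.trans ?_
  rw [eLpNorm_const_smul]
  have h2 : ‖((2 ^ (σ - 1) : ℝ) : ℂ)‖ₑ = ((2 ^ (σ - 1) : ℝ≥0) : ℝ≥0∞) := by
    rw [← ofReal_norm, Complex.norm_real, Real.norm_of_nonneg (by positivity),
      ENNReal.ofReal_pow (by norm_num)]
    norm_num
  have hφa := (hφ2.const_mul ((b ^ σ : ℝ) : ℂ)).1.norm
  have hφb := (memLp_pow_mul (T := T) hφ2 (norm_nonneg k) σ).1.norm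
  have h3 : eLpNorm (fun t => ((‖((b ^ σ : ℝ) : ℂ) * φ t k‖ +
        ‖(((‖k‖ * t) ^ σ : ℝ) : ℂ) * φ t k‖ : ℝ) : ℂ)) 2 μ ≤ (κ⁻¹).toNNReal * N + D * N := by
    rw [eLpNorm_congr_norm_ae (g := (fun t => ‖((b ^ σ : ℝ) : ℂ) * φ t k‖) +
      fun t => ‖(((‖k‖ * t) ^ σ : ℝ) : ℂ) * φ t k‖)
      (Filter.Eventually.of_forall fun t => by rw [Complex.norm_real, Pi.add_apply])]
    refine (eLpNorm_add_le hφa hφb (by norm_num)).trans ?_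
    rw [eLpNorm_norm, eLpNorm_norm]
    exact add_le_add hconst hweight
  rw [h2]
  calc _ ≤ ((2 ^ (σ - 1) : ℝ≥0) : ℝ≥0∞) * ((κ⁻¹).toNNReal * N + D * N) := by gcongr
    _ = ((2 ^ (σ - 1) * ((κ⁻¹).toNNReal + D) : ℝ≥0) : ℝ≥0∞) * N := by push_cast; ring
    _ ≤ _ := by gcongr; exact le_add_self
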